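/- Let $n\ge 2$. A Kropina space is a smooth $n$-dimensional manifold $M$ with a smooth Riemannian metric $\alpha=\sqrt{a_{ij}(x)y^iy^j}$ and a smooth nowhere vanishing 1-form $\beta=b_i(x)y^i$. Its Kropina metric is $$F=\frac{\alpha^2}{\beta},$$ considered on the domain of tangent vectors $y$ with $\beta(y)>0$. In local coordinates put $g_{ij}=\tfrac12[F^2]_{y^iy^j}$, $$G^i=\tfrac14 g^{il}\{[F^2]_{x^ky^l}y^k-[F^2]_{x^l}\},$$ $$R^i{}_k=2\frac{\partial G^i}{\partial x^k}-y^m\frac{\partial^2G^i}{\partial x^m\partial y^k}+2G^m\frac{\partial^2G^i}{\partial y^m\partial y^k}-\frac{\partial G^i}{\partial y^m}\frac{\partial G^m}{\partial y^k},\qquad \mathrm{Ric}=R^m{}_m .$$ $F$ is called Einstein if there is a scalar function $\sigma=\sigma(x)$ on $M$ with $\mathrm{Ric}=\sigma F^2$ at all $(x,y)$ with $\beta(y)>0$. A conformal map between Kropina spaces $(M,F)$ and $(\tilde M,\tilde F)$ of the same dimension $n$ is a smooth local diffeomorphism $f:M\to\tilde M$ for which there is a function $\phi:M\to(0,\infty)$,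 its conformal factor, such that for every $x\in M$ and every $y\in T_xM$ with $\beta(y)>0$ one has $\tilde\beta(df_x(y))>0$ and $$\tilde F(f(x),df_x(y))=\phi(x)^{-1}F(x,y).$$ It is homothetic if it is conformal with a constant conformal factor. **Theorem.** Let $(M,F)$ and $(\tilde M,\tilde F)$ be Einstein Kropina spaces of dimension $n\ge 2$ with $M$ connected. Then every conformal map $f:(M,F)\to(\tilde M,\tilde F)$ is homothetic: its conformal factor $\phi$ is constant. -/

import Mathlib

open scoped Manifold ContDiff

noncomputable section

namespace Kropina

/-! ### Ricci curvature of a Finsler metric in local coordinates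

A function on the tangent bundle is written in local coordinates as `Φ x y`, where `x` is the
position and `y` the fibre coordinate. -/

/-- The coordinate space `ℝⁿ`. -/
abbrev Coord (n : ℕ) : Type := EuclideanSpace ℝ (Fin n)

/-- The partial derivative `∂Φ/∂xⁱ`. -/
def dX {n : ℕ} (i : Fin n) (Φ : Coord n → Coord n → ℝ) : Coord n → Coord n → ℝ :=
  fun x y => fderiv ℝ (fun u => Φ u y) x (EuclideanSpace.single i 1)

/-- The partial derivative `∂Φ/∂yⁱ`. -/
def dY {n : ℕ} (i : Fin n) (Φ : Coord n → Coord n → ℝ) : Coord n → Coord n → ℝ :=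
  fun x y => fderiv ℝ (fun v => Φ x v) y (EuclideanSpace.single i 1)

/-- The fundamental tensor `g_ij = ½ [F²]_{yⁱ yʲ}`. -/
def fundamentalTensor {n : ℕ} (F : Coord n → Coord n → ℝ) (x y : Coord n) :
    Matrix (Fin n) (Fin n) ℝ :=
  Matrix.of fun i j => 1 / 2 * dY j (dY i fun u v => F u v ^ 2) x y

/-- The geodesic coefficients `Gⁱ = ¼ g^{il} ([F²]_{xᵏ yˡ} yᵏ - [F²]_{xˡ})`. -/
def geodesicCoeff {n : ℕ} (F : Coord n → Coord n → ℝ) (i : Fin n) : Coord n → Coord n → ℝ :=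
  fun x y => 1 / 4 * ∑ l, (fundamentalTensor F x y)⁻¹ i l *
    ((∑ k, dY l (dX k fun u v => F u v ^ 2) x y * y k) - dX l (fun u v => F u v ^ 2) x y)

/-- The Riemann curvature
`Rⁱ_k = 2 ∂Gⁱ/∂xᵏ - yᵐ ∂²Gⁱ/∂xᵐ∂yᵏ + 2 Gᵐ ∂²Gⁱ/∂yᵐ∂yᵏ - ∂Gⁱ/∂yᵐ ∂Gᵐ/∂yᵏ`. -/
def riemannCurvature {n : ℕ} (F : Coord n → Coord n → ℝ) (i k : Fin n) (x y : Coord n) : ℝ :=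
  2 * dX k (geodesicCoeff F i) x y
    - (∑ m, dX m (dY k (geodesicCoeff F i)) x y * y m)
    + 2 * (∑ m, geodesicCoeff F m x y * dY m (dY k (geodesicCoeff F i)) x y)
    - ∑ m, dY m (geodesicCoeff F i) x y * dY k (geodesicCoeff F m) x y

/-- The Ricci curvature `Ric = Rᵐ_m`. -/
def ricciCurvature {n : ℕ} (F : Coord n → Coord n → ℝ) (x y : Coord n) : ℝ :=
  ∑ m, riemannCurvature F m m x y

/-! ### Kropina spaces -/

/-- A Kropina structure on an `n`-dimensional smooth manifold `M`: a smooth Riemannian metric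
`α² = a_ij yⁱ yʲ` and a smooth nowhere vanishing 1-form `β = b_i yⁱ`. -/
structure KropinaSpace (n : ℕ) (M : Type*) [TopologicalSpace M] [ChartedSpace (Coord n) M]
    [IsManifold 𝓘(ℝ, Coord n) ∞ M] where
  /-- The Riemannian metric. -/
  α : Bundle.ContMDiffRiemannianMetric 𝓘(ℝ, Coord n) ∞ (Coord n)
    (fun x : M => TangentSpace 𝓘(ℝ, Coord n) x)
  /-- The 1-form. -/
  β : ∀ x : M, TangentSpace 𝓘(ℝ, Coord n) x →L[ℝ] Bundle.Trivial M ℝ x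
  contMDiff_β : ContMDiff 𝓘(ℝ, Coord n) (𝓘(ℝ, Coord n).prod 𝓘(ℝ, Coord n →L[ℝ] ℝ)) ∞
    (fun x : M => Bundle.TotalSpace.mk' (Coord n →L[ℝ] ℝ)
      (E := fun x : M => TangentSpace 𝓘(ℝ, Coord n) x →L[ℝ] Bundle.Trivial M ℝ x) x (β x))
  β_ne_zero : ∀ x : M, β x ≠ 0

section

variable {n : ℕ} {M : Type*} [TopologicalSpace M] [ChartedSpace (Coord n) M]
  [IsManifold 𝓘(ℝ, Coord n) ∞ M]

/-- The open half-space of `T_x M` on which `β > 0`. The Kropina metric is considered only there. -/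
def KropinaSpace.domain (K : KropinaSpace n M) (x : M) : Set (TangentSpace 𝓘(ℝ, Coord n) x) :=
  {y | (0 : ℝ) < K.β x y}

/-- The Kropina metric `F = α² / β`; it is meaningful on `K.domain x` only. -/
def KropinaSpace.F (K : KropinaSpace n M) (x : M) (y : TangentSpace 𝓘(ℝ, Coord n) x) : ℝ :=
  K.α.inner x y y / (K.β x y : ℝ)

/-- The tangent vector at the point with coordinates `u` whose components in the local
coordinates `e` are `v`, that is `vⁱ ∂/∂xⁱ`. -/
def coordVector (e : OpenPartialHomeomorph M (Coord n)) (u v : Coord n) :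
    TangentSpace 𝓘(ℝ, Coord n) (e.symm u) :=
  @mfderiv ℝ _ (Coord n) _ _ (Coord n) _ 𝓘(ℝ, Coord n) (Coord n) _ (chartedSpaceSelf (Coord n))
    (Coord n) _ _ (Coord n) _ 𝓘(ℝ, Coord n) M _ _ e.symm u v

/-- The Kropina metric `F(x, y)` written in the local coordinates `e`. -/
def KropinaSpace.coordF (K : KropinaSpace n M) (e : OpenPartialHomeomorph M (Coord n))
    (u v : Coord n) : ℝ :=
  K.F (e.symm u) (coordVector e u v)

/-- `F` is an Einstein metric: there is a scalar function `σ` on `M` with `Ric = σ F²` wherever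
`β > 0`. The Ricci curvature is computed in local coordinates, and the equation is required
in every smooth coordinate system. -/
def KropinaSpace.IsEinstein (K : KropinaSpace n M) : Prop :=
  ∃ σ : M → ℝ, ∀ e ∈ IsManifold.maximalAtlas 𝓘(ℝ, Coord n) ∞ M, ∀ u ∈ e.target, ∀ v : Coord n,
    coordVector e u v ∈ K.domain (e.symm u) →
      ricciCurvature (K.coordF e) u v = σ (e.symm u) * K.coordF e u v ^ 2

/-- `f` is a conformal map from `(M, F)` to `(M', F')` with conformal factor `φ`: it is a local
diffeomorphism, and `F'(f(x), df_x(y)) = φ(x)⁻¹ F(x, y)` on the domain of `F`, with `φ > 0`.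
No regularity of `φ` is required. -/
structure IsConformalMap {M' : Type*} [TopologicalSpace M'] [ChartedSpace (Coord n) M']
    [IsManifold 𝓘(ℝ, Coord n) ∞ M'] (K : KropinaSpace n M) (K' : KropinaSpace n M')
    (f : M → M') (φ : M → ℝ) : Prop where
  isLocalDiffeomorph : IsLocalDiffeomorph 𝓘(ℝ, Coord n) 𝓘(ℝ, Coord n) ∞ f
  factor_pos : ∀ x, 0 < φ x
  mem_domain : ∀ x, ∀ y ∈ K.domain x,
    mfderiv 𝓘(ℝ, Coord n) 𝓘(ℝ, Coord n) f x y ∈ K'.domain (f x)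
  map_F : ∀ x, ∀ y ∈ K.domain x,
    K'.F (f x) (mfderiv 𝓘(ℝ, Coord n) 𝓘(ℝ, Coord n) f x y) = (φ x)⁻¹ * K.F x y

/-- `f` is homothetic: it is a conformal map with a constant conformal factor. -/
def IsHomothetic {M' : Type*} [TopologicalSpace M'] [ChartedSpace (Coord n) M']
    [IsManifold 𝓘(ℝ, Coord n) ∞ M'] (K : KropinaSpace n M) (K' : KropinaSpace n M')
    (f : M → M') : Prop :=
  ∃ c : ℝ, IsConformalMap K K' f (fun _ => c)

end

end Kropina

end

/-! Write F as h(y,y)/h(W,y) with h a Riemannian metric and W an h-unit field: take for W the α-dual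
of β and divide α² and β by the same function N = β(W). The whole problem is expressed through (h,
W).

The key fact is that the Einstein condition makes W a Killing field of h (`IsMetric.killing`). The
geodesic coefficients of F are Q + P y. Here Q is polynomial in y and 1/β over functions of x, and P
= -S β / h(y,y), where S is half of (L_W h)(y,y). The projective change formula (`ricci_add_mul`)
gives Ric = Ric(Q) + (n-1)(P² - δP), with δ the derivation of the spray Q. Along δ the function
h(y,y) itself changes by -2Sβ modulo h(y,y), so Ric has the double pole 3(n-1)(Sβ)²/h(y,y)²
(`ricci_geod`). An Einstein metric has Ric = σ h(y,y)²/β², which has no such pole. Hence h(y,y)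
divides S² along each line y = W + tX with X orthogonal to W, where β = 1 and h(y,y) = 1 + h(X,X)
t². This quadratic has no real root, but a complex root of it must be a root of S. So S is a
constant multiple of h(y,y) on the line, and the constant is its value at t = 0, which vanishes
because W has unit length (`sum_lie_W`).

A conformal map becomes the identity after transporting a chart, so two Kropina functions satisfy F'
= ψ F with ψ = 1/φ. Linear algebra then forces h' = ψ² h and W' = W/ψ
(`scaling_of_kropina_proportional`). Consequently L_{W'} h' = ψ L_W h + 2 (Wψ) h - dψ⊗W♭ - W♭⊗dψ. If
both fields are Killing, then (Wψ) h(v,v) = dψ(v) h(W,v) for all v. A nonzero v orthogonal to W,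
which exists since n ≥ 2, gives Wψ = 0, and then dψ = 0 (`fderiv_eq_zero_of_killing`). Thus φ is
locally constant, and connectedness finishes.

The curvature computation is carried out in a commutative algebra with commuting derivations, later
specialised to smooth functions on the set β > 0. There "no pole along h(y,y) = 0" means membership
in the subalgebra `regular`. -/

namespace Kropina

open Finset

/-! ### Sprays, the Euler derivation and projective change of Ricci curvature -/

/-- Derivations along position and fibre coordinates on an algebra of functions on a tangent
bundle, together with the fibre coordinates. -/
structure FibreCalculus (R : Type*) [CommRing R] [Algebra ℝ R] (n : ℕ) where
  X : Fin n → Derivation ℝ R R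
  Y : Fin n → Derivation ℝ R R
  y : Fin n → R
  X_Y : ∀ i j f, X i (Y j f) = Y j (X i f)
  Y_Y : ∀ i j f, Y i (Y j f) = Y j (Y i f)
  X_y : ∀ i j, X i (y j) = 0
  Y_y : ∀ i j, Y i (y j) = if i = j then 1 else 0

namespace FibreCalculus

variable {R : Type*} [CommRing R] [Algebra ℝ R] {n : ℕ} (C : FibreCalculus R n)

/-- The derivation `yᵏ ∂/∂xᵏ`. -/
noncomputable def hor : Derivation ℝ R R := ∑ k, C.y k • C.X k

/-- The derivation `Gᵏ ∂/∂yᵏ`. -/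
noncomputable def vert (G : Fin n → R) : Derivation ℝ R R := ∑ k, G k • C.Y k

/-- The derivation `yᵏ ∂/∂xᵏ - 2 Gᵏ ∂/∂yᵏ` attached to the coefficients `G`. -/
noncomputable def spray (G : Fin n → R) : Derivation ℝ R R := C.hor - (2 : R) • C.vert G

/-- The Euler derivation `yᵏ ∂/∂yᵏ`. -/
noncomputable def euler : Derivation ℝ R R := C.vert C.y

/-- The Ricci curvature of the spray with coefficients `G`. -/
noncomputable def ricci (G : Fin n → R) : R :=
  ∑ m, (2 * C.X m (G m) - (∑ k, C.X k (C.Y m (G m)) * C.y k)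
    + 2 * (∑ k, G k * C.Y k (C.Y m (G m))) - ∑ k, C.Y k (G m) * C.Y m (G k))

theorem _root_.Derivation.sum_smul_apply {ι : Type*} (s : Finset ι) (a : ι → R)
    (D : ι → Derivation ℝ R R) (f : R) : (∑ k ∈ s, a k • D k) f = ∑ k ∈ s, a k * D k f := by
  rw [← Derivation.coeFnAddMonoidHom_apply, map_sum, Finset.sum_apply]
  rfl

theorem hor_apply (f : R) : C.hor f = ∑ k, C.y k * C.X k f :=
  Derivation.sum_smul_apply ..

theorem vert_apply (G : Fin n → R) (f : R) : C.vert G f = ∑ k, G k * C.Y k f :=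
  Derivation.sum_smul_apply ..

theorem spray_apply (G : Fin n → R) (f : R) : C.spray G f = C.hor f - 2 * C.vert G f := rfl

theorem euler_apply (f : R) : C.euler f = ∑ k, C.y k * C.Y k f := C.vert_apply ..

theorem hor_y (i : Fin n) : C.hor (C.y i) = 0 := by
  simp [hor_apply, C.X_y]

theorem vert_add_mul (G V : Fin n → R) (u f : R) :
    C.vert (fun k => G k + u * V k) f = C.vert G f + u * C.vert V f := by
  simp only [vert_apply, add_mul, sum_add_distrib, mul_sum, mul_assoc]

theorem spray_add_mul (G V : Fin n → R) (u f : R) :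
    C.spray (fun k => G k + u * V k) f = C.spray G f - 2 * u * C.vert V f := by
  rw [spray_apply, spray_apply, vert_add_mul]; ring

theorem euler_y (i : Fin n) : C.euler (C.y i) = C.y i := by
  simp [euler_apply, C.Y_y]

theorem euler_X (i : Fin n) (f : R) : C.euler (C.X i f) = C.X i (C.euler f) := by
  simp [euler_apply, C.X_y, C.X_Y]

theorem Y_euler (i : Fin n) (f : R) : C.Y i (C.euler f) = C.Y i f + C.euler (C.Y i f) := by
  simp only [euler_apply, map_sum, Derivation.leibniz, C.Y_y, smul_eq_mul, sum_add_distrib]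
  simp [C.Y_Y i, add_comm]

theorem euler_eq_zero {f : R} (hf : ∀ k, C.Y k f = 0) : C.euler f = 0 := by
  simp [euler_apply, hf]

/-- The projective change of the Ricci curvature of a spray. -/
theorem ricci_add_mul (Q : Fin n → R) (P : R) (hQ : ∀ i, C.euler (Q i) = 2 * Q i)
    (hP : C.euler P = P) :
    C.ricci (fun k => Q k + P * C.y k) = C.ricci Q + (n - 1) * (P ^ 2 - C.spray Q P) := by
  have hY : ∀ k m, C.Y k (Q m + P * C.y m)
      = C.Y k (Q m) + C.Y k P * C.y m + if k = m then P else 0 := by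
    intro k m
    simp only [map_add, Derivation.leibniz, C.Y_y, smul_eq_mul]
    split_ifs <;> ring
  have hX : ∀ k m, C.X k (Q m + P * C.y m) = C.X k (Q m) + C.X k P * C.y m := by
    intro k m
    simp only [map_add, Derivation.leibniz, C.X_y, smul_eq_mul]
    ring
  set N : R := ∑ m, C.Y m (Q m) with hN
  have hN' : ∑ m, C.Y m (Q m + P * C.y m) = N + (n + 1) * P := by
    simp only [hY, sum_add_distrib, if_true]
    have : ∑ m, C.Y m P * C.y m = P := by
      conv_rhs => rw [← hP, euler_apply]
      exact sum_congr rfl fun _ _ => mul_comm _ _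
    rw [this]; simp; ring
  -- All but two terms of Ric depend on G through its fibre divergence, which the change of spray
  -- shifts by (n+1) P.
  have hform : ∀ G : Fin n → R, C.ricci G = 2 * ∑ m, C.X m (G m)
      - C.hor (∑ m, C.Y m (G m)) + 2 * C.vert G (∑ m, C.Y m (G m))
      - ∑ m, ∑ k, C.Y k (G m) * C.Y m (G k) := by
    intro G
    simp only [ricci, hor_apply, vert_apply, sum_add_distrib, sum_sub_distrib, mul_sum, map_sum]
    simp only [mul_comm]
  have eN : C.euler N = N := by
    rw [hN, map_sum]
    refine sum_congr rfl fun m _ => ?_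
    have := C.Y_euler m (Q m)
    rw [hQ] at this
    simp only [Derivation.leibniz, smul_eq_mul] at this
    have h2 : C.Y m (2 : R) = 0 := by
      simpa using (C.Y m).map_natCast 2
    rw [h2] at this
    linear_combination -this
  have eP : ∑ k, C.y k * C.Y k P = P := by rw [← euler_apply, hP]
  -- The cross terms collapse by Euler's relation: Q has degree 2 and P degree 1 in y.
  have hprod : ∑ m, ∑ k, C.Y k (Q m + P * C.y m) * C.Y m (Q k + P * C.y k)
      = ∑ m, ∑ k, C.Y k (Q m) * C.Y m (Q k) + 4 * ∑ k, Q k * C.Y k P + 2 * P * N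
        + (n + 3) * P ^ 2 := by
    have h1 : ∀ m k, C.Y k (Q m + P * C.y m) * C.Y m (Q k + P * C.y k)
        = C.Y k (Q m) * C.Y m (Q k) + C.Y m P * (C.y k * C.Y k (Q m))
          + C.Y k P * (C.y m * C.Y m (Q k)) + (C.y k * C.Y k P) * (C.y m * C.Y m P)
          + (if k = m then 2 * P * C.Y m (Q m) + 2 * P * (C.y m * C.Y m P) + P ^ 2 else 0) := by
      intro m k
      rw [hY, hY]
      by_cases h : k = m
      · subst h; simp; ring
      · simp [h, Ne.symm h]; ring
    simp only [h1, sum_add_distrib, sum_ite_eq', mem_univ, if_true]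
    have h2 : ∑ m, ∑ k, C.Y m P * (C.y k * C.Y k (Q m)) = 2 * ∑ k, Q k * C.Y k P := by
      rw [mul_sum]
      refine sum_congr rfl fun m _ => ?_
      rw [← mul_sum, ← euler_apply, hQ]; ring
    have h3 : ∑ m, ∑ k, C.Y k P * (C.y m * C.Y m (Q k)) = 2 * ∑ k, Q k * C.Y k P := by
      rw [sum_comm, h2]
    rw [h2, h3]
    simp only [← mul_sum, ← sum_mul, eP, ← hN]
    simp
    ring
  have hdiv : ∑ m, C.X m (Q m + P * C.y m) = ∑ m, C.X m (Q m) + C.hor P := by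
    simp only [hX, sum_add_distrib, hor_apply, mul_comm]
  have hc : ∀ D : Derivation ℝ R R, D (N + (n + 1) * P) = D N + (n + 1) * D P := by
    intro D
    have h1 : D ((n : R) + 1) = 0 := by exact_mod_cast D.map_natCast (n + 1)
    simp [Derivation.leibniz, h1]
  have hQP : ∑ k, Q k * C.Y k P = C.vert Q P := (C.vert_apply ..).symm
  rw [hform, hform, hN', hprod, hdiv, ← hN, spray_apply, hc, hc, vert_add_mul, vert_add_mul,
    hQP, ← euler, eN, hP]
  ring

end FibreCalculus
end Kropina

/-! ### Geodesic coefficients of a Kropina metric and its Euler-Lagrange equation -/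

namespace Kropina

open Finset

/-- A Kropina metric `h(y, y) / h(W, y)` over a fibre calculus, given by a Riemannian metric `h`
with inverse `hInv` and a unit vector field `W`. The elements `hyyInv` and `βInv` are the inverses
of `h(y, y)` and `h(W, y)`. -/
structure KropinaDatum (R : Type*) [CommRing R] [Algebra ℝ R] (n : ℕ) extends
    FibreCalculus R n where
  h : Fin n → Fin n → R
  hInv : Fin n → Fin n → R
  W : Fin n → R
  hyyInv : R
  βInv : R
  h_symm : ∀ i j, h i j = h j i
  h_mul_hInv : ∀ i j, ∑ k, h i k * hInv k j = if i = j then 1 else 0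
  hInv_mul_h : ∀ i j, ∑ k, hInv i k * h k j = if i = j then 1 else 0
  Y_h : ∀ k i j, Y k (h i j) = 0
  Y_W : ∀ k i, Y k (W i) = 0
  W_unit : ∑ i, ∑ j, h i j * W i * W j = 1
  hyyInv_mul : hyyInv * ∑ i, ∑ j, h i j * y i * y j = 1
  βInv_mul : βInv * ∑ i, ∑ j, h i j * W i * y j = 1

namespace KropinaDatum

variable {R : Type*} [CommRing R] [Algebra ℝ R] {n : ℕ} (D : KropinaDatum R n)

local notation "κ" => algebraMap ℝ R (1 / 2)

theorem two_mul_half : (2 : R) * κ = 1 := by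
  have : algebraMap ℝ R (2 * (1 / 2)) = 1 := by norm_num
  rwa [map_mul, map_ofNat] at this

/-- The square `h(y, y)` of the Riemannian norm. -/
def hyy : R := ∑ i, ∑ j, D.h i j * D.y i * D.y j

/-- The 1-form `h(W, y)`. -/
def β : R := ∑ i, ∑ j, D.h i j * D.W i * D.y j

/-- Lowering of indices. -/
def lower (V : Fin n → R) (i : Fin n) : R := ∑ j, D.h i j * V j

/-- Raising of indices. -/
def raise (V : Fin n → R) (i : Fin n) : R := ∑ j, D.hInv i j * V j

theorem lower_raise (V : Fin n → R) (i : Fin n) : D.lower (D.raise V) i = V i := by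
  simp only [lower, raise, mul_sum]
  rw [sum_comm]
  simp only [← mul_assoc, ← sum_mul, D.h_mul_hInv]
  simp

theorem sum_lower_mul (U V : Fin n → R) :
    ∑ i, D.lower U i * V i = ∑ i, D.lower V i * U i := by
  simp only [lower, sum_mul]
  rw [sum_comm]
  refine sum_congr rfl fun i _ => sum_congr rfl fun j _ => ?_
  rw [D.h_symm]; ring

theorem hyy_eq : D.hyy = ∑ i, D.lower D.y i * D.y i := by
  simp only [hyy, lower, sum_mul]
  exact sum_congr rfl fun i _ => sum_congr rfl fun j _ => by ring

theorem β_eq : D.β = ∑ i, D.lower D.W i * D.y i := by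
  simp only [β, lower, sum_mul]
  rw [sum_comm]
  exact sum_congr rfl fun i _ => sum_congr rfl fun j _ => by rw [D.h_symm]

theorem sum_lower_W_mul_W : ∑ i, D.lower D.W i * D.W i = 1 := by
  rw [← D.W_unit]
  simp only [lower, sum_mul]
  exact sum_congr rfl fun i _ => sum_congr rfl fun j _ => by ring

theorem mul_hyyInv : D.hyy * D.hyyInv = 1 := by rw [mul_comm]; exact D.hyyInv_mul

theorem mul_βInv : D.β * D.βInv = 1 := by rw [mul_comm]; exact D.βInv_mul

theorem Y_lower_y (k i : Fin n) : D.Y k (D.lower D.y i) = D.h i k := by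
  simp [lower, Derivation.leibniz, D.Y_h, D.Y_y]

theorem Y_lower_W (k i : Fin n) : D.Y k (D.lower D.W i) = 0 := by
  simp [lower, Derivation.leibniz, D.Y_h, D.Y_W]

theorem Y_hyy (k : Fin n) : D.Y k D.hyy = 2 * D.lower D.y k := by
  have : ∑ i, D.y i * D.h i k = D.lower D.y k :=
    sum_congr rfl fun i _ => by rw [D.h_symm]; ring
  rw [hyy_eq]
  simp only [map_sum, Derivation.leibniz, smul_eq_mul, Y_lower_y, D.Y_y, sum_add_distrib, this]
  simp; ring

theorem Y_β (k : Fin n) : D.Y k D.β = D.lower D.W k := by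
  rw [β_eq]
  simp [Derivation.leibniz, Y_lower_W, D.Y_y]

theorem Y_hInv (k i j : Fin n) : D.Y k (D.hInv i j) = 0 := by
  have key : ∀ i, D.lower (fun m => D.Y k (D.hInv m j)) i = 0 := by
    intro i
    have h1 := congrArg (D.Y k) (D.h_mul_hInv i j)
    have h2 : D.Y k (if i = j then 1 else 0) = 0 := by split_ifs <;> simp
    rw [h2] at h1
    simpa [lower, Derivation.leibniz, D.Y_h] using h1
  have : D.raise (D.lower (fun m => D.Y k (D.hInv m j))) i = D.Y k (D.hInv i j) := by
    simp only [lower, raise, mul_sum]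
    rw [sum_comm]
    simp only [← mul_assoc, ← sum_mul, D.hInv_mul_h]
    simp
  rw [← this]
  simp [raise, key]

/-- The Kropina metric `h(y, y) / h(W, y)`. -/
def F : R := D.hyy * D.βInv

theorem F_mul_β : D.F * D.β = D.hyy := by
  rw [F, mul_assoc, mul_comm D.βInv, mul_βInv, mul_one]

/-- The lowered geodesic coefficients of `h`. -/
noncomputable def riemLow (l : Fin n) : R := κ * D.hor (D.lower D.y l) - κ * κ * D.X l D.hyy

/-- The geodesic coefficients of `h`. -/
noncomputable def riem : Fin n → R := D.raise D.riemLow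

/-- The antisymmetric part `½ (∂ₖ βᵢ - ∂ᵢ βₖ) yᵏ` of the derivative of `β`. -/
noncomputable def curl (i : Fin n) : R := κ * (D.hor (D.lower D.W i) - D.X i D.β)

/-- The contraction of `curl` with `W`. -/
noncomputable def curlW : R := ∑ i, D.curl i * D.W i

/-- The symmetric part `½ (L_W h)(y, y)` of the derivative of `β`. -/
noncomputable def strain : R := D.spray D.riem D.β

/-- The part of the geodesic coefficients of `F` which is regular along `h(y, y) = 0`. -/
noncomputable def reg (k : Fin n) : R :=
  D.riem k + -D.curlW * D.y k + κ * (D.strain + D.F * D.curlW) * D.W k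
    + -κ * D.F * D.raise D.curl k

/-- The projective factor of the geodesic coefficients of `F`, singular along `h(y, y) = 0`. -/
noncomputable def proj : R := -D.strain * D.β * D.hyyInv

/-- The geodesic coefficients of `F`. -/
noncomputable def geod (k : Fin n) : R := D.reg k + D.proj * D.y k

theorem vert_β (V : Fin n → R) : D.vert V D.β = ∑ i, D.lower D.W i * V i := by
  simp only [FibreCalculus.vert_apply, Y_β, mul_comm]

theorem vert_lower_y (V : Fin n → R) (i : Fin n) : D.vert V (D.lower D.y i) = D.lower V i := by
  simp only [FibreCalculus.vert_apply, Y_lower_y]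
  exact sum_congr rfl fun _ _ => mul_comm _ _

theorem vert_lower_W (V : Fin n → R) (i : Fin n) : D.vert V (D.lower D.W i) = 0 := by
  simp only [FibreCalculus.vert_apply, Y_lower_W, mul_zero, sum_const_zero]

theorem vert_hyy (V : Fin n → R) : D.vert V D.hyy = 2 * ∑ i, D.lower D.y i * V i := by
  simp only [FibreCalculus.vert_apply, Y_hyy, mul_sum]
  exact sum_congr rfl fun _ _ => by ring

theorem hor_hyy : D.hor D.hyy = ∑ l, D.y l * D.hor (D.lower D.y l) := by
  rw [hyy_eq]
  simp [Derivation.leibniz, FibreCalculus.hor_y]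

theorem hor_β : D.hor D.β = ∑ l, D.y l * D.hor (D.lower D.W l) := by
  rw [β_eq]
  simp [Derivation.leibniz, FibreCalculus.hor_y]

/-- An antisymmetric form contracted twice with y: both halves of `curl` contribute κ times the
derivative of β along `hor`. -/
theorem sum_y_curl : ∑ i, D.curl i * D.y i = 0 := by
  simp only [curl, mul_sub, sub_mul, sum_sub_distrib]
  rw [sub_eq_zero]
  calc _ = κ * D.hor D.β := by rw [hor_β, mul_sum]; exact sum_congr rfl fun _ _ => by ring
    _ = _ := by rw [FibreCalculus.hor_apply, mul_sum]; exact sum_congr rfl fun _ _ => by ring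

theorem sum_riemLow_y : ∑ i, D.riemLow i * D.y i = κ * κ * D.hor D.hyy := by
  simp only [riemLow, sub_mul, sum_sub_distrib]
  have h1 : ∑ i, κ * D.hor (D.lower D.y i) * D.y i = κ * D.hor D.hyy := by
    rw [hor_hyy, mul_sum]; exact sum_congr rfl fun _ _ => by ring
  have h2 : ∑ i, κ * κ * D.X i D.hyy * D.y i = κ * κ * D.hor D.hyy := by
    rw [FibreCalculus.hor_apply, mul_sum]; exact sum_congr rfl fun _ _ => by ring
  rw [h1, h2]
  linear_combination (- κ * D.hor D.hyy) * two_mul_half (R := R)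

/-- The geodesic equation of h in Euler-Lagrange form. -/
theorem spray_riem_lower_y (i : Fin n) :
    2 * D.spray D.riem (D.lower D.y i) = D.X i D.hyy := by
  rw [FibreCalculus.spray_apply, vert_lower_y, riem, lower_raise, riemLow]
  linear_combination (-2 * D.hor (D.lower D.y i) + (1 + 2 * κ) * D.X i D.hyy)
    * two_mul_half (R := R)

/-- Geodesics of h have constant speed. -/
theorem spray_riem_hyy : D.spray D.riem D.hyy = 0 := by
  rw [FibreCalculus.spray_apply, vert_hyy, sum_lower_mul]
  simp only [riem, lower_raise]
  rw [sum_riemLow_y]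
  linear_combination (- (1 + 2 * κ) * D.hor D.hyy) * two_mul_half (R := R)

theorem sum_lower_W_raise (V : Fin n → R) :
    ∑ i, D.lower D.W i * D.raise V i = ∑ i, V i * D.W i := by
  rw [sum_lower_mul]; simp only [lower_raise]

theorem sum_lower_y_raise (V : Fin n → R) :
    ∑ i, D.lower D.y i * D.raise V i = ∑ i, V i * D.y i := by
  rw [sum_lower_mul]; simp only [lower_raise]

theorem spray_reg (f : R) : D.spray D.reg f = D.spray D.riem f + 2 * D.curlW * D.euler f
    - (D.strain + D.F * D.curlW) * D.vert D.W f + D.F * D.vert (D.raise D.curl) f := by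
  unfold reg
  rw [FibreCalculus.spray_add_mul, FibreCalculus.spray_add_mul, FibreCalculus.spray_add_mul,
    FibreCalculus.euler]
  linear_combination (-(D.strain + D.F * D.curlW) * D.vert D.W f
    + D.F * D.vert (D.raise D.curl) f) * two_mul_half (R := R)

theorem spray_geod (f : R) :
    D.spray D.geod f = D.spray D.reg f - 2 * D.proj * D.euler f := by
  unfold geod
  rw [FibreCalculus.spray_add_mul, FibreCalculus.euler]

/-- The null cone of h is not invariant under the regular part of the spray. The first term measures
the failure, and it supplies two of the three units in the leading coefficient of `ricci_geod`. -/
theorem spray_reg_hyy : D.spray D.reg D.hyy = 2 * (-D.strain * D.β) + 2 * D.curlW * D.hyy := by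
  have h1 : D.vert (D.raise D.curl) D.hyy = 0 := by
    rw [vert_hyy, sum_lower_y_raise, sum_y_curl, mul_zero]
  have h2 : D.vert D.W D.hyy = 2 * D.β := by rw [vert_hyy, sum_lower_mul, β_eq]
  have h3 : D.euler D.hyy = 2 * D.hyy := by rw [FibreCalculus.euler, vert_hyy, hyy_eq]
  rw [spray_reg, spray_riem_hyy, h1, h2, h3]
  linear_combination -2 * D.curlW * D.F_mul_β

theorem euler_β : D.euler D.β = D.β := by rw [FibreCalculus.euler, vert_β, β_eq]

theorem euler_hyy : D.euler D.hyy = 2 * D.hyy := by rw [FibreCalculus.euler, vert_hyy, hyy_eq]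

/-- The logarithmic derivative of `β` along the geodesic spray of `F`. -/
noncomputable def θ : R := 2 * (D.strain * D.β * D.hyyInv + D.curlW)

theorem spray_geod_β : D.spray D.geod D.β = D.θ * D.β := by
  rw [spray_geod, spray_reg, euler_β, vert_β, vert_β, sum_lower_W_mul_W, sum_lower_W_raise,
    ← strain, ← curlW, θ, proj]
  ring

theorem spray_geod_hyy : D.spray D.geod D.hyy = D.θ * D.hyy := by
  rw [spray_geod, spray_reg_hyy, euler_hyy, proj, θ]
  linear_combination (2 * D.strain * D.β) * D.mul_hyyInv

/-- Numerator and denominator of F have the same logarithmic derivative `θ` along the spray, so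
their quotient is constant. -/
theorem spray_geod_F : D.spray D.geod D.F = 0 := by
  have h1 := congrArg (D.spray D.geod) D.F_mul_β
  rw [Derivation.leibniz, spray_geod_hyy, spray_geod_β, smul_eq_mul, smul_eq_mul] at h1
  linear_combination D.βInv * h1 - D.spray D.geod D.F * D.mul_βInv - D.θ * D.βInv * D.F_mul_β

theorem Y_F_mul (i : Fin n) :
    D.Y i D.F * D.β = 2 * D.lower D.y i - D.F * D.lower D.W i := by
  have h1 := congrArg (D.Y i) D.F_mul_β
  rw [Derivation.leibniz, Y_β, Y_hyy, smul_eq_mul, smul_eq_mul] at h1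
  linear_combination h1

theorem spray_geod_Y_F (i : Fin n) : D.spray D.geod (D.Y i D.F) = D.X i D.F := by
  have h1 := congrArg (D.spray D.geod) (D.Y_F_mul i)
  have h2 := congrArg (D.X i) D.F_mul_β
  have h3 : D.spray D.geod (2 : R) = 0 := by simpa using (D.spray D.geod).map_natCast 2
  have h4 : D.spray D.geod (D.lower D.W i) = 2 * D.curl i + D.X i D.β := by
    rw [spray_geod, spray_reg, FibreCalculus.euler, vert_lower_W, vert_lower_W, vert_lower_W,
      FibreCalculus.spray_apply, vert_lower_W, curl]
    linear_combination (- D.hor (D.lower D.W i) + D.X i D.β) * two_mul_half (R := R)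
  have h5 : 2 * D.spray D.geod (D.lower D.y i) = D.X i D.hyy + 4 * D.curlW * D.lower D.y i
      - 2 * (D.strain + D.F * D.curlW) * D.lower D.W i + 2 * D.F * D.curl i
      - 4 * D.proj * D.lower D.y i := by
    rw [spray_geod, spray_reg, FibreCalculus.euler, vert_lower_y, vert_lower_y, vert_lower_y,
      lower_raise]
    linear_combination D.spray_riem_lower_y i
  simp only [map_sub, Derivation.leibniz, smul_eq_mul, h3, h4, spray_geod_F, spray_geod_β] at h1 h2
  rw [h5] at h1
  -- Differentiating the relations for β times the fibre derivative of F and for F β gives the claim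
  -- only after multiplication by β, which is then cancelled with `βInv`.
  have h6 : (D.spray D.geod (D.Y i D.F) - D.X i D.F) * D.β = 0 := by
    rw [proj, θ] at h1
    linear_combination h1 - h2 - 2 * (D.strain * D.β * D.hyyInv + D.curlW) * D.Y_F_mul i
      + 2 * D.strain * D.lower D.W i * (D.hyyInv * D.F_mul_β + D.mul_hyyInv)
  linear_combination D.βInv * h6 - (D.spray D.geod (D.Y i D.F) - D.X i D.F) * D.mul_βInv

/-- The Euler-Lagrange equation of `F`. -/
theorem spray_geod_Y_F_sq (i : Fin n) :
    D.spray D.geod (D.Y i (D.F ^ 2)) = D.X i (D.F ^ 2) := by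
  have h3 : D.spray D.geod (2 : R) = 0 := by simpa using (D.spray D.geod).map_natCast 2
  rw [pow_two, Derivation.leibniz, Derivation.leibniz]
  simp only [smul_eq_mul, map_add, Derivation.leibniz, spray_geod_F, spray_geod_Y_F]
  ring

end KropinaDatum
end Kropina

/-! ### Homogeneity, regular elements and the pole of the Ricci curvature -/

namespace Kropina

open Finset

namespace KropinaDatum

variable {R : Type*} [CommRing R] [Algebra ℝ R] {n : ℕ} (D : KropinaDatum R n)

local notation "κ" => algebraMap ℝ R (1 / 2)

theorem euler_lower_y (i : Fin n) : D.euler (D.lower D.y i) = D.lower D.y i := by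
  rw [FibreCalculus.euler, vert_lower_y]

theorem euler_X (i : Fin n) (f : R) : D.euler (D.X i f) = D.X i (D.euler f) :=
  D.toFibreCalculus.euler_X i f

theorem euler_hor (f : R) : D.euler (D.hor f) = D.hor f + D.hor (D.euler f) := by
  simp only [FibreCalculus.hor_apply, map_sum, Derivation.leibniz, smul_eq_mul,
    D.toFibreCalculus.euler_X, FibreCalculus.euler_y, sum_add_distrib]
  rw [add_comm]
  exact congrArg₂ _ (sum_congr rfl fun _ _ => mul_comm _ _) rfl

theorem euler_two_mul (f : R) : D.euler (2 * f) = 2 * D.euler f := by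
  rw [two_mul, map_add, two_mul]

theorem X_two_mul (i : Fin n) (f : R) : D.X i (2 * f) = 2 * D.X i f := by
  rw [two_mul, map_add, two_mul]

theorem euler_raise (V : Fin n → R) (i : Fin n) :
    D.euler (D.raise V i) = D.raise (fun j => D.euler (V j)) i := by
  have : ∀ i j, D.euler (D.hInv i j) = 0 := fun i j => D.euler_eq_zero fun k => D.Y_hInv k i j
  simp [raise, Derivation.leibniz, this]

theorem euler_W (i : Fin n) : D.euler (D.W i) = 0 := D.euler_eq_zero fun k => D.Y_W k i

theorem euler_lower_W (i : Fin n) : D.euler (D.lower D.W i) = 0 :=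
  D.euler_eq_zero fun k => D.Y_lower_W k i

theorem euler_riemLow (i : Fin n) : D.euler (D.riemLow i) = 2 * D.riemLow i := by
  rw [riemLow, map_sub, Derivation.leibniz, Derivation.leibniz, euler_hor, euler_lower_y, euler_X,
    euler_hyy, X_two_mul, ← map_mul, Derivation.map_algebraMap, Derivation.map_algebraMap]
  simp only [smul_eq_mul, map_mul]
  ring

theorem euler_riem (i : Fin n) : D.euler (D.riem i) = 2 * D.riem i := by
  rw [riem, euler_raise]
  simp only [euler_riemLow, raise, mul_sum]
  exact sum_congr rfl fun _ _ => by ring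

theorem euler_curl (i : Fin n) : D.euler (D.curl i) = D.curl i := by
  simp only [curl, map_sub, Derivation.leibniz, smul_eq_mul, Derivation.map_algebraMap,
    euler_hor, euler_lower_W, euler_X, euler_β, map_zero]
  ring

theorem euler_curlW : D.euler D.curlW = D.curlW := by
  simp [curlW, Derivation.leibniz, euler_curl, euler_W, mul_comm]

theorem strain_eq : D.strain = D.hor D.β - 2 * ∑ i, D.riemLow i * D.W i := by
  rw [strain, FibreCalculus.spray_apply, vert_β, riem, sum_lower_W_raise]

theorem euler_strain : D.euler D.strain = 2 * D.strain := by
  rw [strain_eq, map_sub, euler_two_mul, map_sum]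
  simp only [Derivation.leibniz, smul_eq_mul, euler_riemLow, euler_W, euler_hor, euler_β]
  simp only [mul_zero, zero_add, mul_left_comm _ (2 : R), ← mul_sum]
  rw [sum_congr rfl fun i _ => mul_comm (D.W i) (D.riemLow i)]
  ring

theorem map_βInv (δ : Derivation ℝ R R) : δ D.βInv = -(D.βInv ^ 2 * δ D.β) := by
  rw [δ.leibniz_of_mul_eq_one ((mul_comm _ _).trans D.mul_βInv), smul_eq_mul, neg_mul]

theorem map_hyyInv (δ : Derivation ℝ R R) : δ D.hyyInv = -(D.hyyInv ^ 2 * δ D.hyy) := by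
  rw [δ.leibniz_of_mul_eq_one ((mul_comm _ _).trans D.mul_hyyInv), smul_eq_mul, neg_mul]

theorem euler_βInv : D.euler D.βInv = -D.βInv := by
  rw [map_βInv, euler_β]
  linear_combination -D.βInv * D.mul_βInv

theorem euler_hyyInv : D.euler D.hyyInv = -2 * D.hyyInv := by
  rw [map_hyyInv, euler_hyy]
  linear_combination -2 * D.hyyInv * D.mul_hyyInv

theorem euler_F : D.euler D.F = D.F := by
  rw [F, Derivation.leibniz, euler_hyy, euler_βInv, smul_eq_mul, smul_eq_mul]
  ring

theorem euler_reg (i : Fin n) : D.euler (D.reg i) = 2 * D.reg i := by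
  simp only [reg, map_add, map_neg, Derivation.leibniz, smul_eq_mul, Derivation.map_algebraMap,
    euler_riem, euler_curlW, FibreCalculus.euler_y, euler_strain, euler_F, euler_W,
    euler_raise, euler_curl]
  ring

theorem euler_proj : D.euler D.proj = D.proj := by
  simp only [proj, map_neg, Derivation.leibniz, smul_eq_mul, euler_strain, euler_β, euler_hyyInv]
  ring

/-- The subalgebra of elements which are polynomial in the fibre coordinates and `β⁻¹`. -/
def regular : Subalgebra ℝ R :=
  Algebra.adjoin ℝ ({c | ∀ k, D.Y k c = 0} ∪ Set.range D.y ∪ {D.βInv})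

theorem mem_regular_of_Y_eq_zero {c : R} (hc : ∀ k, D.Y k c = 0) : c ∈ D.regular :=
  Algebra.subset_adjoin (.inl (.inl hc))

theorem y_mem (i : Fin n) : D.y i ∈ D.regular :=
  Algebra.subset_adjoin (.inl (.inr ⟨i, rfl⟩))

theorem βInv_mem : D.βInv ∈ D.regular :=
  Algebra.subset_adjoin (.inr rfl)

theorem h_mem (i j : Fin n) : D.h i j ∈ D.regular :=
  D.mem_regular_of_Y_eq_zero fun k => D.Y_h k i j

theorem hInv_mem (i j : Fin n) : D.hInv i j ∈ D.regular :=
  D.mem_regular_of_Y_eq_zero fun k => D.Y_hInv k i j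

theorem W_mem (i : Fin n) : D.W i ∈ D.regular :=
  D.mem_regular_of_Y_eq_zero fun k => D.Y_W k i

theorem raise_mem {V : Fin n → R} (hV : ∀ i, V i ∈ D.regular) (i : Fin n) :
    D.raise V i ∈ D.regular :=
  sum_mem fun j _ => mul_mem (D.hInv_mem i j) (hV j)

theorem lower_mem {V : Fin n → R} (hV : ∀ i, V i ∈ D.regular) (i : Fin n) :
    D.lower V i ∈ D.regular :=
  sum_mem fun j _ => mul_mem (D.h_mem i j) (hV j)

theorem β_mem : D.β ∈ D.regular := by
  rw [β_eq]; exact sum_mem fun i _ => mul_mem (D.lower_mem D.W_mem i) (D.y_mem i)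

theorem hyy_mem : D.hyy ∈ D.regular := by
  rw [hyy_eq]; exact sum_mem fun i _ => mul_mem (D.lower_mem D.y_mem i) (D.y_mem i)

theorem Y_mem {f : R} (hf : f ∈ D.regular) (k : Fin n) : D.Y k f ∈ D.regular := by
  induction hf using Algebra.adjoin_induction with
  | mem x hx =>
    rcases hx with (hx | ⟨i, rfl⟩) | hx
    · rw [hx k]; exact zero_mem _
    · rw [D.Y_y]; split_ifs
      exacts [one_mem _, zero_mem _]
    · rw [Set.mem_singleton_iff.1 hx, map_βInv, Y_β]
      exact neg_mem (mul_mem (pow_mem D.βInv_mem 2) (D.lower_mem D.W_mem k))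
  | algebraMap r => rw [Derivation.map_algebraMap]; exact zero_mem _
  | add f g _ _ hf hg => rw [map_add]; exact add_mem hf hg
  | mul f g hf' hg' hf hg =>
    rw [Derivation.leibniz]; exact add_mem (mul_mem hf' hg) (mul_mem hg' hf)

/-- Position derivatives commute with fibre derivatives, so they preserve the coefficients that are
constant on fibres; differentiating `βInv` creates only further powers of `βInv`. -/
theorem X_mem {f : R} (hf : f ∈ D.regular) (k : Fin n) : D.X k f ∈ D.regular := by
  have hconst : ∀ c, (∀ k, D.Y k c = 0) → D.X k c ∈ D.regular := fun c hc =>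
    D.mem_regular_of_Y_eq_zero fun j => by rw [← D.X_Y, hc, map_zero]
  induction hf using Algebra.adjoin_induction with
  | mem x hx =>
    rcases hx with (hx | ⟨i, rfl⟩) | hx
    · exact hconst x hx
    · rw [D.X_y]; exact zero_mem _
    · rw [Set.mem_singleton_iff.1 hx, map_βInv, β_eq]
      refine neg_mem (mul_mem (pow_mem D.βInv_mem 2) ?_)
      rw [map_sum]
      refine sum_mem fun i _ => ?_
      rw [Derivation.leibniz, D.X_y, smul_zero, zero_add]
      exact mul_mem (D.y_mem i) (hconst _ fun j => D.Y_lower_W j i)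
  | algebraMap r => rw [Derivation.map_algebraMap]; exact zero_mem _
  | add f g _ _ hf hg => rw [map_add]; exact add_mem hf hg
  | mul f g hf' hg' hf hg =>
    rw [Derivation.leibniz]; exact add_mem (mul_mem hf' hg) (mul_mem hg' hf)

theorem hor_mem {f : R} (hf : f ∈ D.regular) : D.hor f ∈ D.regular := by
  rw [FibreCalculus.hor_apply]; exact sum_mem fun k _ => mul_mem (D.y_mem k) (D.X_mem hf k)

theorem two_mem : (2 : R) ∈ D.regular := ofNat_mem _ 2

theorem spray_mem {G : Fin n → R} (hG : ∀ i, G i ∈ D.regular) {f : R} (hf : f ∈ D.regular) :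
    D.spray G f ∈ D.regular := by
  rw [FibreCalculus.spray_apply, FibreCalculus.vert_apply]
  exact sub_mem (D.hor_mem hf)
    (mul_mem D.two_mem (sum_mem fun k _ => mul_mem (hG k) (D.Y_mem hf k)))

theorem ricci_mem {G : Fin n → R} (hG : ∀ i, G i ∈ D.regular) : D.ricci G ∈ D.regular := by
  refine sum_mem fun m _ => ?_
  have hX := fun k i => D.X_mem (hG i) k
  have hY := fun k i => D.Y_mem (hG i) k
  exact sub_mem (add_mem (sub_mem (mul_mem D.two_mem (hX m m))
    (sum_mem fun k _ => mul_mem (D.X_mem (hY m m) k) (D.y_mem k)))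
    (mul_mem D.two_mem (sum_mem fun k _ => mul_mem (hG k) (D.Y_mem (hY m m) k))))
    (sum_mem fun k _ => mul_mem (hY k m) (hY m k))

theorem riem_mem (i : Fin n) : D.riem i ∈ D.regular :=
  D.raise_mem (fun j => sub_mem
    (mul_mem (algebraMap_mem _ _) (D.hor_mem (D.lower_mem D.y_mem j)))
    (mul_mem (mul_mem (algebraMap_mem _ _) (algebraMap_mem _ _)) (D.X_mem D.hyy_mem j))) i

theorem strain_mem : D.strain ∈ D.regular := D.spray_mem D.riem_mem D.β_mem

theorem curl_mem (i : Fin n) : D.curl i ∈ D.regular :=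
  mul_mem (algebraMap_mem _ _)
    (sub_mem (D.hor_mem (D.lower_mem D.W_mem i)) (D.X_mem D.β_mem i))

theorem curlW_mem : D.curlW ∈ D.regular :=
  sum_mem fun i _ => mul_mem (D.curl_mem i) (D.W_mem i)

theorem F_mem : D.F ∈ D.regular := mul_mem D.hyy_mem D.βInv_mem

theorem reg_mem (i : Fin n) : D.reg i ∈ D.regular := by
  have hκ : κ ∈ D.regular := algebraMap_mem _ _
  exact add_mem (add_mem (add_mem (D.riem_mem i) (mul_mem (neg_mem D.curlW_mem) (D.y_mem i)))
    (mul_mem (mul_mem hκ (add_mem D.strain_mem (mul_mem D.F_mem D.curlW_mem))) (D.W_mem i)))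
    (mul_mem (mul_mem (neg_mem hκ) D.F_mem) (D.raise_mem D.curl_mem i))

/-- The leading singularity of the Ricci curvature of a Kropina metric along the null cone of
the Riemannian metric. -/
theorem ricci_geod : ∃ t ∈ D.regular,
    D.hyy ^ 2 * D.ricci D.geod = 3 * (n - 1) * (D.strain * D.β) ^ 2 + D.hyy * t := by
  set p := -D.strain * D.β with hp
  have hpmem : p ∈ D.regular := mul_mem (neg_mem D.strain_mem) D.β_mem
  refine ⟨D.hyy * D.ricci D.reg + (n - 1) * (2 * D.curlW * p - D.spray D.reg p), ?_, ?_⟩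
  · exact add_mem (mul_mem D.hyy_mem (D.ricci_mem D.reg_mem))
      (mul_mem (sub_mem (natCast_mem _ n) (one_mem _))
        (sub_mem (mul_mem (mul_mem D.two_mem D.curlW_mem) hpmem) (D.spray_mem D.reg_mem hpmem)))
  have h1 : D.ricci D.geod = _ := D.ricci_add_mul D.reg D.proj D.euler_reg D.euler_proj
  -- Differentiating 1/h(y,y) in P = p/h(y,y) produces -2p²/h(y,y)². With the P² of the projective
  -- change formula this makes 3p²/h(y,y)².
  have h2 : D.spray D.reg D.proj
      = D.hyyInv * D.spray D.reg p - p * D.hyyInv ^ 2 * (2 * p + 2 * D.curlW * D.hyy) := by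
    rw [← D.spray_reg_hyy, proj, ← hp, Derivation.leibniz,
      map_hyyInv, smul_eq_mul, smul_eq_mul]
    ring
  rw [h1, h2, proj, ← hp]
  have e := D.mul_hyyInv
  have e2 : D.hyy ^ 2 * D.hyyInv ^ 2 = 1 := by rw [← mul_pow, e, one_pow]
  linear_combination (n - 1) * (3 * p ^ 2 + 2 * p * D.curlW * D.hyy) * e2
    - (n - 1) * D.hyy * D.spray D.reg p * e

/-- The Lie derivative of the Riemannian metric along `W`. -/
noncomputable def lie (i j : Fin n) : R :=
  ∑ k, (D.W k * D.X k (D.h i j) + D.h k j * D.X i (D.W k) + D.h i k * D.X j (D.W k))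

/-- Identifies the coefficient of the pole geometrically: it vanishes in every direction exactly
when the quadratic form of L_W h does. The Christoffel terms in `strain` combine into the derivative
of h along W. -/
theorem two_mul_strain : 2 * D.strain = ∑ i, ∑ j, D.lie i j * D.y i * D.y j := by
  have h1 : D.β = ∑ i, D.lower D.y i * D.W i := by rw [β_eq, sum_lower_mul]
  have h2 : D.hor D.β = ∑ i, (D.lower D.y i * D.hor (D.W i) + D.W i * D.hor (D.lower D.y i)) := by
    rw [h1]; simp [Derivation.leibniz]
  have h3 : 2 * D.strain
      = 2 * ∑ i, D.lower D.y i * D.hor (D.W i) + ∑ k, D.W k * D.X k D.hyy := by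
    have h4 : ∑ i, D.riemLow i * D.W i = κ * ∑ i, D.W i * D.hor (D.lower D.y i)
        - κ * κ * ∑ k, D.W k * D.X k D.hyy := by
      rw [mul_sum, mul_sum, ← sum_sub_distrib]
      exact sum_congr rfl fun _ _ => by rw [riemLow]; ring
    rw [strain_eq, h2, h4, sum_add_distrib]
    linear_combination (-2 * ∑ i, D.W i * D.hor (D.lower D.y i)
      + (1 + 2 * κ) * ∑ k, D.W k * D.X k D.hyy) * two_mul_half (R := R)
  have h5 : ∑ k, D.W k * D.X k D.hyy
      = ∑ i, ∑ j, ∑ k, D.W k * D.X k (D.h i j) * D.y i * D.y j := by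
    rw [sum_congr rfl fun i _ => sum_comm, sum_comm]
    refine sum_congr rfl fun k _ => ?_
    simp only [hyy, map_sum, Derivation.leibniz, D.X_y, smul_eq_mul, mul_sum, mul_zero, zero_add]
    exact sum_congr rfl fun _ _ => sum_congr rfl fun _ _ => by ring
  have h6 : ∑ i, D.lower D.y i * D.hor (D.W i)
      = ∑ i, ∑ j, ∑ k, D.h k j * D.X i (D.W k) * D.y i * D.y j := by
    rw [sum_congr rfl fun i _ => sum_comm, sum_comm]
    refine sum_congr rfl fun k _ => ?_
    simp only [FibreCalculus.hor_apply, lower, sum_mul_sum]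
    rw [sum_comm]
    exact sum_congr rfl fun _ _ => sum_congr rfl fun _ _ => by ring
  have h7 : ∑ i, ∑ j, ∑ k, D.h i k * D.X j (D.W k) * D.y i * D.y j
      = ∑ i, ∑ j, ∑ k, D.h k j * D.X i (D.W k) * D.y i * D.y j := by
    rw [sum_comm]
    refine sum_congr rfl fun _ _ => sum_congr rfl fun _ _ => sum_congr rfl fun _ _ => ?_
    rw [D.h_symm]; ring
  rw [h3, h5, two_mul]
  nth_rewrite 2 [h6]
  rw [← h7, h6]
  simp only [lie, sum_mul, ← sum_add_distrib]
  exact sum_congr rfl fun _ _ => sum_congr rfl fun _ _ => sum_congr rfl fun _ _ => by ring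

end KropinaDatum
end Kropina

/-! ### Smooth functions on an open set as an algebra with commuting derivations -/

namespace Kropina

open Finset TopologicalSpace

section SmoothFunctions

variable {V : Type*} [NormedAddCommGroup V] (Ω : Opens V)

/-- Extension by zero of a function on an open set. -/
noncomputable def extendZero (f : Ω → ℝ) : V → ℝ := Function.extend Subtype.val f 0

theorem extendZero_coe (f : Ω → ℝ) (p : Ω) : extendZero Ω f p = f p :=
  Subtype.val_injective.extend_apply f 0 p

variable [NormedSpace ℝ V]

theorem contDiffOn_extendZero_iff {f : Ω → ℝ} {g : V → ℝ} (hg : ∀ p : Ω, g p = f p) :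
    ContDiffOn ℝ ∞ (extendZero Ω f) Ω ↔ ContDiffOn ℝ ∞ g Ω :=
  contDiffOn_congr fun p hp => (extendZero_coe Ω f ⟨p, hp⟩).trans (hg ⟨p, hp⟩).symm

/-- The algebra of smooth functions on an open set of a normed space. -/
noncomputable def smoothFun : Subalgebra ℝ (Ω → ℝ) where
  carrier := {f | ContDiffOn ℝ ∞ (extendZero Ω f) Ω}
  mul_mem' {f g} hf hg := (contDiffOn_extendZero_iff Ω fun p => by
    simp [extendZero_coe]).2 (hf.mul hg)
  add_mem' {f g} hf hg := (contDiffOn_extendZero_iff Ω fun p => by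
    simp [extendZero_coe]).2 (hf.add hg)
  algebraMap_mem' r := (contDiffOn_extendZero_iff Ω (g := fun _ => r) fun p => rfl).2
    contDiffOn_const

variable {Ω}

/-- The smooth function on `Ω` given by a function on the whole space. -/
noncomputable def smoothFun.mk (g : V → ℝ) (hg : ContDiffOn ℝ ∞ g Ω) : smoothFun Ω :=
  ⟨fun p => g p, (contDiffOn_extendZero_iff Ω fun _ => rfl).2 hg⟩

/-- Evaluation of smooth functions at a point. -/
noncomputable def smoothFun.ev (p : Ω) : smoothFun Ω →ₐ[ℝ] ℝ :=
  (Pi.evalAlgHom ℝ (fun _ : Ω => ℝ) p).comp (smoothFun Ω).val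

theorem smoothFun.ext_ev {f g : smoothFun Ω} (h : ∀ p, ev p f = ev p g) : f = g :=
  Subtype.ext (funext h)

theorem smoothFun.ev_mk (p : Ω) (g : V → ℝ) (hg : ContDiffOn ℝ ∞ g Ω) : ev p (mk g hg) = g p :=
  rfl

theorem smoothFun.isUnit {f : smoothFun Ω} (hf : ∀ p, ev p f ≠ 0) : IsUnit f := by
  have hinv : ContDiffOn ℝ ∞ (fun p => (extendZero Ω f p)⁻¹) Ω :=
    f.2.inv fun p hp => by rw [extendZero_coe Ω f ⟨p, hp⟩]; exact hf ⟨p, hp⟩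
  refine IsUnit.of_mul_eq_one (mk _ hinv) (ext_ev fun p => ?_)
  rw [map_mul, map_one, ev_mk, extendZero_coe]
  exact mul_inv_cancel₀ (hf p)

/-- The function `g` on the whole space restricts to `f` on `Ω`. -/
def smoothFun.Represents (g : V → ℝ) (f : smoothFun Ω) : Prop := ∀ p : Ω, g p = ev p f

theorem smoothFun.Represents.contDiffOn {g : V → ℝ} {f : smoothFun Ω} (h : Represents g f) :
    ContDiffOn ℝ ∞ g Ω := (contDiffOn_extendZero_iff Ω h).1 f.2

theorem smoothFun.Represents.differentiableAt {g : V → ℝ} {f : smoothFun Ω}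
    (h : Represents g f) (p : Ω) : DifferentiableAt ℝ g p :=
  (h.contDiffOn.contDiffAt (Ω.isOpen.mem_nhds p.2)).differentiableAt (by simp)

theorem smoothFun.represents_extendZero (f : smoothFun Ω) : Represents (extendZero Ω f) f :=
  extendZero_coe Ω f

theorem smoothFun.Represents.fderiv_eq {g : V → ℝ} {f : smoothFun Ω} (h : Represents g f)
    (p : Ω) : fderiv ℝ g p = fderiv ℝ (extendZero Ω f) p := by
  refine Filter.EventuallyEq.fderiv_eq ?_
  filter_upwards [Ω.isOpen.mem_nhds p.2] with q hq
  rw [h ⟨q, hq⟩, represents_extendZero f ⟨q, hq⟩]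

theorem smoothFun.contDiffOn_fderiv (f : smoothFun Ω) :
    ContDiffOn ℝ ∞ (fderiv ℝ (extendZero Ω f)) Ω :=
  ContDiffOn.fderiv_of_isOpen f.2 Ω.isOpen (by simp)

/-- The directional derivative. -/
noncomputable def smoothFun.dir (w : V) : Derivation ℝ (smoothFun Ω) (smoothFun Ω) :=
  Derivation.mk'
    { toFun f := mk (fun p => fderiv ℝ (extendZero Ω f) p w)
        ((contDiffOn_fderiv f).clm_apply contDiffOn_const)
      map_add' f g := ext_ev fun p => by
        have : Represents (extendZero Ω f + extendZero Ω g) (f + g) := fun p => by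
          simp [represents_extendZero _ p]
        rw [map_add, ev_mk, ev_mk, ev_mk, ← this.fderiv_eq,
          fderiv_add ((represents_extendZero f).differentiableAt p)
            ((represents_extendZero g).differentiableAt p)]
        rfl
      map_smul' r f := ext_ev fun p => by
        have : Represents (r • extendZero Ω f) (r • f) := fun p => by
          simp [represents_extendZero _ p]
        rw [map_smul, ev_mk, ev_mk, ← this.fderiv_eq,
          fderiv_const_smul ((represents_extendZero f).differentiableAt p)]
        rfl }
    fun f g => ext_ev fun p => by
      have : Represents (extendZero Ω f * extendZero Ω g) (f * g) := fun p => by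
        simp [represents_extendZero _ p]
      simp only [LinearMap.coe_mk, AddHom.coe_mk, map_add, smul_eq_mul, map_mul, ev_mk]
      rw [← this.fderiv_eq, fderiv_mul ((represents_extendZero f).differentiableAt p)
            ((represents_extendZero g).differentiableAt p), ← represents_extendZero f p,
        ← represents_extendZero g p]
      rfl

theorem smoothFun.ev_dir (w : V) (f : smoothFun Ω) (p : Ω) :
    ev p (dir w f) = fderiv ℝ (extendZero Ω f) p w := rfl

theorem smoothFun.Represents.dir {g : V → ℝ} {f : smoothFun Ω} (h : Represents g f) (w : V) :
    Represents (fun p => fderiv ℝ g p w) (dir w f) := fun p => by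
  rw [ev_dir, ← h.fderiv_eq]

/-- Symmetry of the second derivative. -/
theorem smoothFun.dir_comm (v w : V) (f : smoothFun Ω) : dir v (dir w f) = dir w (dir v f) := by
  have key : ∀ v w : V, ∀ p : Ω,
      ev p (smoothFun.dir v (smoothFun.dir w f))
        = fderiv ℝ (fderiv ℝ (extendZero Ω f)) p v w := by
    intro v w p
    have hd : DifferentiableAt ℝ (fderiv ℝ (extendZero Ω f)) p :=
      ((contDiffOn_fderiv f).contDiffAt (Ω.isOpen.mem_nhds p.2)).differentiableAt (by simp)
    rw [← ((represents_extendZero f).dir w).dir v p]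
    beta_reduce
    rw [fderiv_clm_apply hd (differentiableAt_const w)]
    simp
  refine ext_ev fun p => ?_
  rw [key, key]
  have : ContDiffAt ℝ ∞ (extendZero Ω f) p := f.2.contDiffAt (Ω.isOpen.mem_nhds p.2)
  exact (this.isSymmSndFDerivAt (by
    rw [minSmoothness_of_isRCLikeNormedField]; exact WithTop.coe_le_coe.2 le_top)) v w

end SmoothFunctions

section TangentCoordinates

variable {n : ℕ}

open smoothFun

/-- The partial derivatives on an open set of the tangent bundle of the coordinate space. -/
noncomputable def tangentCalculus (Ω : Opens (Coord n × Coord n)) :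
    FibreCalculus (smoothFun Ω) n where
  X k := dir (EuclideanSpace.single k 1, 0)
  Y k := dir (0, EuclideanSpace.single k 1)
  y k := smoothFun.mk (fun p => p.2 k) (by fun_prop)
  X_Y _ _ _ := dir_comm ..
  Y_Y _ _ _ := dir_comm ..
  X_y i j := ext_ev fun p => by
    have h : Represents (fun p => p.2 j) (smoothFun.mk (Ω := Ω) (fun p => p.2 j) (by fun_prop)) :=
      fun _ => rfl
    rw [← h.dir _ p, show (fun p : Coord n × Coord n => p.2 j)
      = (EuclideanSpace.proj j).comp (ContinuousLinearMap.snd ℝ (Coord n) (Coord n)) from rfl]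
    beta_reduce
    rw [ContinuousLinearMap.fderiv]
    simp
  Y_y i j := ext_ev fun p => by
    have h : Represents (fun p => p.2 j) (smoothFun.mk (Ω := Ω) (fun p => p.2 j) (by fun_prop)) :=
      fun _ => rfl
    rw [← h.dir _ p, show (fun p : Coord n × Coord n => p.2 j)
      = (EuclideanSpace.proj j).comp (ContinuousLinearMap.snd ℝ (Coord n) (Coord n)) from rfl]
    beta_reduce
    rw [ContinuousLinearMap.fderiv]
    by_cases hij : i = j
    · simp [hij]
    · simp [hij, Ne.symm hij]

variable {Ω : Opens (Coord n × Coord n)} {Φ : Coord n → Coord n → ℝ} {f : smoothFun Ω}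

theorem represents_dX (h : Represents (fun p => Φ p.1 p.2) f) (k : Fin n) :
    Represents (fun p => dX k Φ p.1 p.2) ((tangentCalculus Ω).X k f) := fun p => by
  refine Eq.trans ?_ (h.dir _ p)
  have hd : HasFDerivAt (fun q : Coord n × Coord n => Φ q.1 q.2) _ (p.1.1, p.1.2) :=
    (h.differentiableAt p).hasFDerivAt
  have := hd.comp (f := fun u => (u, p.1.2)) p.1.1 (hasFDerivAt_prodMk_left p.1.1 p.1.2)
  simp only [dX]
  exact congrArg (fun L => L (EuclideanSpace.single k 1)) this.fderiv

theorem represents_dY (h : Represents (fun p => Φ p.1 p.2) f) (k : Fin n) :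
    Represents (fun p => dY k Φ p.1 p.2) ((tangentCalculus Ω).Y k f) := fun p => by
  refine Eq.trans ?_ (h.dir _ p)
  have hd : HasFDerivAt (fun q : Coord n × Coord n => Φ q.1 q.2) _ (p.1.1, p.1.2) :=
    (h.differentiableAt p).hasFDerivAt
  have := hd.comp (f := fun v => (p.1.1, v)) p.1.2 (hasFDerivAt_prodMk_right p.1.1 p.1.2)
  simp only [dY]
  exact congrArg (fun L => L (EuclideanSpace.single k 1)) this.fderiv

theorem represents_ricci {F : Coord n → Coord n → ℝ} {G : Fin n → smoothFun Ω}
    (hG : ∀ i, Represents (fun p => geodesicCoeff F i p.1 p.2) (G i)) :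
    Represents (fun p => ricciCurvature F p.1 p.2) ((tangentCalculus Ω).ricci G) := fun p => by
  have hX := fun i k => represents_dX (hG i) k
  have hY := fun i k => represents_dY (hG i) k
  have hXY := fun i k j => represents_dX (hY i k) j
  have hYY := fun i k j => represents_dY (hY i k) j
  have hy : ∀ k, ev p ((tangentCalculus Ω).y k) = p.1.2 k := fun _ => rfl
  simp only [ricciCurvature, riemannCurvature, FibreCalculus.ricci, map_sum, map_add, map_sub,
    map_mul, map_ofNat, hy]
  simp only [← hX _ _ p, ← hY _ _ p, ← hXY _ _ _ p, ← hYY _ _ _ p, ← hG _ p]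

end TangentCoordinates

end Kropina

/-! ### Navigation data in coordinates and identification of the geodesic coefficients -/

namespace Kropina

open Finset TopologicalSpace smoothFun

namespace KropinaDatum

variable {R : Type*} [CommRing R] [Algebra ℝ R] {n : ℕ} (D : KropinaDatum R n)

/-- Since W commutes with itself, (L_W h)(W,W) is the derivative of h(W,W) = 1 along W. -/
theorem sum_lie_W : ∑ i, ∑ j, D.lie i j * D.W i * D.W j = 0 := by
  have h1 : ∀ k, ∑ i, ∑ j, (D.X k (D.h i j) * D.W i * D.W j
      + D.h i j * D.X k (D.W i) * D.W j + D.h i j * D.W i * D.X k (D.W j)) = 0 := by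
    intro k
    have := congrArg (D.X k) D.W_unit
    simp only [map_sum, Derivation.leibniz, Derivation.map_one_eq_zero, smul_eq_mul] at this
    rw [← this]
    exact sum_congr rfl fun _ _ => sum_congr rfl fun _ _ => by ring
  have h2 : ∑ k, D.W k * ∑ i, ∑ j, (D.X k (D.h i j) * D.W i * D.W j
      + D.h i j * D.X k (D.W i) * D.W j + D.h i j * D.W i * D.X k (D.W j)) = 0 := by
    simp only [h1, mul_zero, sum_const_zero]
  rw [← h2]
  simp only [lie, sum_mul, mul_sum, mul_add, add_mul, sum_add_distrib]
  have e1 : ∑ i, ∑ j, ∑ k, D.W k * D.X k (D.h i j) * D.W i * D.W j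
      = ∑ k, ∑ i, ∑ j, D.W k * (D.X k (D.h i j) * D.W i * D.W j) := by
    rw [sum_congr rfl fun i _ => sum_comm, sum_comm]
    exact sum_congr rfl fun _ _ => sum_congr rfl fun _ _ => sum_congr rfl fun _ _ => by ring
  have e2 : ∑ i, ∑ j, ∑ k, D.h k j * D.X i (D.W k) * D.W i * D.W j
      = ∑ k, ∑ i, ∑ j, D.W k * (D.h i j * D.X k (D.W i) * D.W j) := by
    rw [sum_congr rfl fun i _ => sum_comm]
    exact sum_congr rfl fun _ _ => sum_congr rfl fun _ _ => sum_congr rfl fun _ _ => by ring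
  have e3 : ∑ i, ∑ j, ∑ k, D.h i k * D.X j (D.W k) * D.W i * D.W j
      = ∑ k, ∑ i, ∑ j, D.W k * (D.h i j * D.W i * D.X k (D.W j)) := by
    rw [sum_comm]
    exact sum_congr rfl fun _ _ => sum_congr rfl fun _ _ => sum_congr rfl fun _ _ => by ring
  rw [e1, e2, e3]

/-- Euler's relation for the fibre derivatives of F², which have degree 1. -/
theorem sum_y_Y_Y_F_sq (j : Fin n) :
    ∑ i, D.y i * D.Y j (D.Y i (D.F ^ 2)) = 2 * D.F * D.Y j D.F := by
  have h1 := D.toFibreCalculus.Y_euler j (D.F ^ 2)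
  have h2 : D.euler (D.F ^ 2) = D.F ^ 2 + D.F ^ 2 := by
    rw [pow_two, Derivation.leibniz, euler_F, smul_eq_mul]
  rw [h2, map_add, add_left_cancel_iff] at h1
  simp only [D.Y_Y j]
  rw [← FibreCalculus.euler_apply, ← h1, pow_two, Derivation.leibniz, smul_eq_mul]
  ring

theorem Y_Y_F_sq (i j : Fin n) :
    D.Y j (D.Y i (D.F ^ 2)) = 2 * (D.Y j D.F * D.Y i D.F + D.F * D.Y j (D.Y i D.F)) := by
  rw [pow_two, Derivation.leibniz, map_add, smul_eq_mul, Derivation.leibniz, smul_eq_mul,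
    smul_eq_mul]
  ring

theorem Y_Y_F_mul (i j : Fin n) : D.Y j (D.Y i D.F) * D.β
    = 2 * D.h i j - D.Y i D.F * D.lower D.W j - D.Y j D.F * D.lower D.W i := by
  have h1 := congrArg (D.Y j) (D.Y_F_mul i)
  have h3 : D.Y j (2 : R) = 0 := by simpa using (D.Y j).map_natCast 2
  simp only [map_sub, Derivation.leibniz, smul_eq_mul, Y_β, Y_lower_y, Y_lower_W, h3] at h1
  linear_combination h1

end KropinaDatum

/-- The bilinear form with matrix `a`. -/
def bil {n : ℕ} (a : Fin n → Fin n → ℝ) (u v : Fin n → ℝ) : ℝ := ∑ i, ∑ j, a i j * u i * v j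

section Bil

variable {n : ℕ} (a : Fin n → Fin n → ℝ)

theorem bil_add_left (u u' v : Fin n → ℝ) : bil a (u + u') v = bil a u v + bil a u' v := by
  simp [bil, mul_add, add_mul, sum_add_distrib]

theorem bil_add_right (u v v' : Fin n → ℝ) : bil a u (v + v') = bil a u v + bil a u v' := by
  simp [bil, mul_add, sum_add_distrib]

theorem bil_smul_left (c : ℝ) (u v : Fin n → ℝ) : bil a (c • u) v = c * bil a u v := by
  simp only [bil, mul_sum, Pi.smul_apply, smul_eq_mul]
  exact sum_congr rfl fun _ _ => sum_congr rfl fun _ _ => by ring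

theorem bil_smul_right (c : ℝ) (u v : Fin n → ℝ) : bil a u (c • v) = c * bil a u v := by
  simp only [bil, mul_sum, Pi.smul_apply, smul_eq_mul]
  exact sum_congr rfl fun _ _ => sum_congr rfl fun _ _ => by ring

theorem bil_comm {a : Fin n → Fin n → ℝ} (ha : ∀ i j, a i j = a j i) (u v : Fin n → ℝ) :
    bil a u v = bil a v u := by
  simp only [bil]
  rw [sum_comm]
  exact sum_congr rfl fun _ _ => sum_congr rfl fun _ _ => by rw [ha]; ring

end Bil

/-- A kernel vector of the matrix at a point would have zero length there; a function without zeros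
is a unit of `smoothFun`. -/
theorem isUnit_det_of_pos {V : Type*} [NormedAddCommGroup V] [NormedSpace ℝ V] {Ω : Opens V}
    {n : ℕ} {A : Matrix (Fin n) (Fin n) (smoothFun Ω)}
    (hA : ∀ p, ∀ v, v ≠ 0 → 0 < bil (fun i j => ev p (A i j)) v v) : IsUnit A.det := by
  refine smoothFun.isUnit fun p hp => ?_
  rw [AlgHom.map_det] at hp
  obtain ⟨v, hv, hv0⟩ := Matrix.exists_mulVec_eq_zero_iff.2 hp
  refine (hA p v hv).ne' ?_
  have : bil (fun i j => ev p (A i j)) v v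
      = v ⬝ᵥ (Matrix.mulVec ((ev p).mapMatrix A) v) := by
    simp only [bil, dotProduct, Matrix.mulVec, mul_sum]
    exact sum_congr rfl fun i _ => sum_congr rfl fun j _ => by
      change _ = v i * (ev p (A i j) * v j)
      ring
  rw [this, hv0, dotProduct_zero]

/-- The navigation data of a Kropina metric on an open set of the coordinate space: a Riemannian
metric `h` and a unit vector field `W`. -/
structure NavigationData (n : ℕ) where
  U : Opens (Coord n)
  h : Coord n → Fin n → Fin n → ℝ
  W : Coord n → Fin n → ℝ
  contDiffOn_h : ∀ i j, ContDiffOn ℝ ∞ (fun x => h x i j) U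
  contDiffOn_W : ∀ i, ContDiffOn ℝ ∞ (fun x => W x i) U
  symm : ∀ x ∈ U, ∀ i j, h x i j = h x j i
  pos : ∀ x ∈ U, ∀ v, v ≠ 0 → 0 < bil (h x) v v
  unit : ∀ x ∈ U, bil (h x) (W x) (W x) = 1

namespace NavigationData

variable {n : ℕ} (L : NavigationData n)

theorem contDiffOn_fst {g : Coord n → ℝ} {s : Set (Coord n × Coord n)}
    (hg : ContDiffOn ℝ ∞ g L.U) (hs : ∀ p ∈ s, p.1 ∈ L.U) :
    ContDiffOn ℝ ∞ (fun p : Coord n × Coord n => g p.1) s :=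
  hg.comp _root_.contDiffOn_fst hs

/-- The domain of the Kropina metric in the tangent bundle. -/
def domain : Opens (Coord n × Coord n) where
  carrier := {p | p.1 ∈ L.U ∧ 0 < bil (L.h p.1) (L.W p.1) p.2.ofLp}
  is_open' := by
    have hc : ContinuousOn (fun p : Coord n × Coord n => bil (L.h p.1) (L.W p.1) p.2.ofLp)
        ((L.U : Set (Coord n)) ×ˢ Set.univ) := by
      refine continuousOn_finsetSum _ fun i _ => continuousOn_finsetSum _ fun j _ => ?_
      refine ((L.contDiffOn_fst (L.contDiffOn_h i j) fun p hp => hp.1).mul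
        (L.contDiffOn_fst (L.contDiffOn_W i) fun p hp => hp.1)).continuousOn.mul ?_
      fun_prop
    convert hc.isOpen_inter_preimage (L.U.isOpen.prod isOpen_univ) (isOpen_Ioi (a := 0)) using 1
    ext p; simp

/-- The Riemannian metric as smooth functions on the domain. -/
noncomputable def hFun (i j : Fin n) : smoothFun L.domain :=
  smoothFun.mk (fun p => L.h p.1 i j) (L.contDiffOn_fst (L.contDiffOn_h i j) fun _ hp => hp.1)

/-- The unit vector field as smooth functions on the domain. -/
noncomputable def WFun (i : Fin n) : smoothFun L.domain :=
  smoothFun.mk (fun p => L.W p.1 i) (L.contDiffOn_fst (L.contDiffOn_W i) fun _ hp => hp.1)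

theorem isUnit_det : IsUnit (Matrix.of L.hFun).det :=
  isUnit_det_of_pos fun p v hv => L.pos p.1.1 p.2.1 v hv

theorem ne_zero_of_mem (p : L.domain) : p.1.2.ofLp ≠ 0 := fun h0 => by
  have := p.2.2
  rw [h0] at this
  simp [bil] at this

theorem isUnit_hyy :
    IsUnit (∑ i, ∑ j, L.hFun i j * (tangentCalculus L.domain).y i
      * (tangentCalculus L.domain).y j) := by
  refine smoothFun.isUnit fun p => ?_
  simp only [map_sum, map_mul]
  exact (L.pos _ p.2.1 _ (L.ne_zero_of_mem p)).ne'

theorem isUnit_β :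
    IsUnit (∑ i, ∑ j, L.hFun i j * L.WFun i * (tangentCalculus L.domain).y j) := by
  refine smoothFun.isUnit fun p => ?_
  simp only [map_sum, map_mul]
  exact p.2.2.ne'

theorem represents_fst {g : Coord n → ℝ} (hg : ContDiffOn ℝ ∞ g L.U) (i : Fin n) :
    Represents (fun p => fderiv ℝ g p.1 (EuclideanSpace.single i 1))
      ((tangentCalculus L.domain).X i
        (smoothFun.mk (fun p => g p.1) (L.contDiffOn_fst hg fun _ hp => hp.1))) :=
  represents_dX (Φ := fun x _ => g x) (fun _ => rfl) i

theorem Y_fst {g : Coord n → ℝ} (hg : ContDiffOn ℝ ∞ g L.U) (i : Fin n) :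
    (tangentCalculus L.domain).Y i
        (smoothFun.mk (fun p => g p.1) (L.contDiffOn_fst hg fun _ hp => hp.1)) = 0 :=
  ext_ev fun p => by
    rw [← represents_dY (Φ := fun x _ => g x) (fun _ => rfl) i p]
    simp [dY]

/-- The Kropina datum over the smooth functions on the domain. -/
noncomputable def datum : KropinaDatum (smoothFun L.domain) n where
  toFibreCalculus := tangentCalculus L.domain
  h := L.hFun
  hInv i j := (Matrix.of L.hFun)⁻¹ i j
  W := L.WFun
  hyyInv := ↑(L.isUnit_hyy.unit⁻¹)
  βInv := ↑(L.isUnit_β.unit⁻¹)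
  h_symm i j := ext_ev fun p => L.symm _ p.2.1 i j
  h_mul_hInv i j := by
    have := congrFun₂ (Matrix.mul_nonsing_inv _ L.isUnit_det) i j
    rwa [Matrix.mul_apply, Matrix.one_apply] at this
  hInv_mul_h i j := by
    have := congrFun₂ (Matrix.nonsing_inv_mul _ L.isUnit_det) i j
    rwa [Matrix.mul_apply, Matrix.one_apply] at this
  Y_h k i j := L.Y_fst (L.contDiffOn_h i j) k
  Y_W k i := L.Y_fst (L.contDiffOn_W i) k
  W_unit := ext_ev fun p => by
    simp only [map_sum, map_mul, map_one]
    exact L.unit _ p.2.1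
  hyyInv_mul := L.isUnit_hyy.val_inv_mul
  βInv_mul := L.isUnit_β.val_inv_mul

theorem ev_hyy (p : L.domain) : ev p L.datum.hyy = bil (L.h p.1.1) p.1.2.ofLp p.1.2.ofLp := by
  simp only [KropinaDatum.hyy, map_sum, map_mul]; rfl

theorem ev_β (p : L.domain) : ev p L.datum.β = bil (L.h p.1.1) (L.W p.1.1) p.1.2.ofLp := by
  simp only [KropinaDatum.β, map_sum, map_mul]; rfl

/-- `F` is the Kropina metric with navigation data `L`. -/
def IsMetric (F : Coord n → Coord n → ℝ) : Prop := ∀ x ∈ L.U, ∀ v : Coord n,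
  0 < bil (L.h x) (L.W x) v.ofLp →
    F x v = bil (L.h x) v.ofLp v.ofLp / bil (L.h x) (L.W x) v.ofLp

variable {L} {F : Coord n → Coord n → ℝ}

theorem IsMetric.represents (hF : L.IsMetric F) :
    Represents (fun p => F p.1 p.2) L.datum.F := fun p => by
  beta_reduce
  rw [hF _ p.2.1 _ p.2.2, div_eq_iff p.2.2.ne', ← ev_hyy, ← ev_β, ← map_mul, KropinaDatum.F_mul_β]

theorem ev_F_pos (p : L.domain) : 0 < ev p L.datum.F := by
  have h1 := congrArg (ev p) L.datum.F_mul_β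
  rw [map_mul, ev_hyy, ev_β] at h1
  exact pos_of_mul_pos_left (h1 ▸ L.pos _ p.2.1 _ (L.ne_zero_of_mem p)) p.2.2.le

/-- Nondegeneracy of the fundamental tensor. Contracting with y gives dF(v) = 0, so v also lies in
the kernel of the Hessian of F. By `Y_Y_F_mul`, 2h is β times that Hessian plus terms containing dF,
so h(v,v) = 0. -/
theorem eq_zero_of_hessian (p : L.domain) (v : Fin n → ℝ)
    (hv : ∀ i, ∑ j, ev p (L.datum.Y j (L.datum.Y i (L.datum.F ^ 2))) * v j = 0) : v = 0 := by
  set D := L.datum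
  have hFp := ev_F_pos p
  have hf : ∑ j, ev p (D.Y j D.F) * v j = 0 := by
    have h1 : ∑ i, ev p (D.y i) * ∑ j, ev p (D.Y j (D.Y i (D.F ^ 2))) * v j = 0 := by
      simp only [hv, mul_zero, sum_const_zero]
    have h2 : ∑ i, ev p (D.y i) * ∑ j, ev p (D.Y j (D.Y i (D.F ^ 2))) * v j
        = 2 * ev p D.F * ∑ j, ev p (D.Y j D.F) * v j := by
      simp only [mul_sum]
      rw [sum_comm]
      refine sum_congr rfl fun j _ => ?_
      have := congrArg (ev p) (D.sum_y_Y_Y_F_sq j)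
      simp only [map_sum, map_mul, map_ofNat] at this
      rw [← mul_assoc, ← this, sum_mul]
      exact sum_congr rfl fun i _ => by ring
    rw [h2] at h1
    exact (mul_eq_zero.1 h1).resolve_left (by positivity)
  have hH : ∀ i, ∑ j, ev p (D.Y j (D.Y i D.F)) * v j = 0 := by
    intro i
    have h1 := hv i
    have h2 : ∑ j, ev p (D.Y j (D.Y i (D.F ^ 2))) * v j
        = 2 * ev p (D.Y i D.F) * (∑ j, ev p (D.Y j D.F) * v j)
          + 2 * ev p D.F * ∑ j, ev p (D.Y j (D.Y i D.F)) * v j := by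
      rw [mul_sum, mul_sum, ← sum_add_distrib]
      refine sum_congr rfl fun j _ => ?_
      rw [D.Y_Y_F_sq]
      simp only [map_add, map_mul, map_ofNat]
      ring
    rw [h2, hf, mul_zero, zero_add] at h1
    exact (mul_eq_zero.1 h1).resolve_left (by positivity)
  by_contra hne
  have hpos := L.pos p.1.1 p.2.1 v hne
  have h1 : ∀ i j, 2 * L.h p.1.1 i j = ev p (D.Y j (D.Y i D.F)) * ev p D.β
      + ev p (D.Y i D.F) * ev p (D.lower D.W j) + ev p (D.Y j D.F) * ev p (D.lower D.W i) := by
    intro i j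
    have := congrArg (ev p) (D.Y_Y_F_mul i j)
    simp only [map_sub, map_mul, map_ofNat] at this
    change _ = 2 * L.h p.1.1 i j - _ - _ at this
    linarith
  have h2 : 2 * bil (L.h p.1.1) v v = ev p D.β * (∑ i, v i * ∑ j, ev p (D.Y j (D.Y i D.F)) * v j)
      + (∑ i, ev p (D.Y i D.F) * v i) * (∑ j, ev p (D.lower D.W j) * v j)
      + (∑ j, ev p (D.lower D.W j) * v j) * (∑ i, ev p (D.Y i D.F) * v i) := by
    rw [sum_mul_sum, sum_mul_sum]
    simp only [bil, mul_sum, ← sum_add_distrib]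
    refine sum_congr rfl fun i _ => sum_congr rfl fun j _ => ?_
    linear_combination v i * v j * h1 i j
  simp only [hH, hf, mul_zero, zero_mul, sum_const_zero, add_zero] at h2
  linarith

/-- The Euler-Lagrange equation `spray_geod_Y_F_sq` says that the fundamental tensor g applied to
`geod` is a quarter of the bracket in `geodesicCoeff`; g is invertible by `eq_zero_of_hessian`. -/
theorem IsMetric.represents_geod (hF : L.IsMetric F) (i : Fin n) :
    Represents (fun p => geodesicCoeff F i p.1 p.2) (L.datum.geod i) := fun p => by
  set D := L.datum with hD
  have hF2 : Represents (fun p => F p.1 p.2 ^ 2) (D.F ^ 2) := fun p => by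
    rw [map_pow, ← hF.represents p]
  have hX : ∀ k, Represents (fun p => dX k (fun u v => F u v ^ 2) p.1 p.2) (D.X k (D.F ^ 2)) :=
    fun k => represents_dX (Φ := fun u v => F u v ^ 2) hF2 k
  have hY : ∀ k, Represents (fun p => dY k (fun u v => F u v ^ 2) p.1 p.2) (D.Y k (D.F ^ 2)) :=
    fun k => represents_dY (Φ := fun u v => F u v ^ 2) hF2 k
  have hYX : ∀ k l, Represents (fun p => dY l (dX k fun u v => F u v ^ 2) p.1 p.2)
      (D.Y l (D.X k (D.F ^ 2))) := fun k l => represents_dY (hX k) l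
  have hYY : ∀ k l, Represents (fun p => dY l (dY k fun u v => F u v ^ 2) p.1 p.2)
      (D.Y l (D.Y k (D.F ^ 2))) := fun k l => represents_dY (hY k) l
  have eX : ∀ k, dX k (fun u v => F u v ^ 2) p.1.1 p.1.2 = ev p (D.X k (D.F ^ 2)) :=
    fun k => hX k p
  have eYX : ∀ k l, dY l (dX k fun u v => F u v ^ 2) p.1.1 p.1.2
      = ev p (D.Y l (D.X k (D.F ^ 2))) := fun k l => hYX k l p
  have eYY : ∀ k l, dY l (dY k fun u v => F u v ^ 2) p.1.1 p.1.2
      = ev p (D.Y l (D.Y k (D.F ^ 2))) := fun k l => hYY k l p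
  set g := fundamentalTensor F p.1.1 p.1.2 with hg
  have hgv : ∀ (v : Fin n → ℝ) i, 2 * g.mulVec v i
      = ∑ j, ev p (D.Y j (D.Y i (D.F ^ 2))) * v j := by
    intro v i
    rw [hg, Matrix.mulVec, dotProduct, mul_sum]
    refine sum_congr rfl fun j _ => ?_
    rw [fundamentalTensor, Matrix.of_apply, eYY i j]
    ring
  have hdet : IsUnit g.det := by
    rw [isUnit_iff_ne_zero]
    intro h0
    obtain ⟨v, hv, hv0⟩ := Matrix.exists_mulVec_eq_zero_iff.2 h0
    exact hv (eq_zero_of_hessian p v fun i => by rw [← hgv, hv0]; simp)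
  have hrhs : ∀ l, (∑ k, dY l (dX k fun u v => F u v ^ 2) p.1.1 p.1.2 * p.1.2 k)
      - dX l (fun u v => F u v ^ 2) p.1.1 p.1.2
      = 4 * g.mulVec (fun k => ev p (D.geod k)) l := by
    intro l
    have h1 := congrArg (ev p) (D.spray_geod_Y_F_sq l)
    rw [FibreCalculus.spray_apply, FibreCalculus.hor_apply, FibreCalculus.vert_apply] at h1
    simp only [map_sub, map_mul, map_sum, map_ofNat] at h1
    rw [eX l, ← h1, show (4 : ℝ) = 2 * 2 by norm_num, mul_assoc, hgv]
    have h2 : ∑ k, dY l (dX k fun u v => F u v ^ 2) p.1.1 p.1.2 * p.1.2 k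
        = ∑ k, ev p (D.y k) * ev p (D.X k (D.Y l (D.F ^ 2))) := by
      refine sum_congr rfl fun k _ => ?_
      rw [eYX k l, D.X_Y, mul_comm]; rfl
    rw [h2]
    simp only [mul_comm]
    ring
  simp only [geodesicCoeff]
  simp only [hrhs]
  have h3 := congrFun (Matrix.mulVec_mulVec (fun k => ev p (D.geod k)) g⁻¹ g) i
  rw [Matrix.nonsing_inv_mul _ hdet, Matrix.one_mulVec] at h3
  rw [← h3]
  conv_rhs => rw [Matrix.mulVec, dotProduct]
  rw [mul_sum]
  exact sum_congr rfl fun _ _ => by rw [← hg]; ring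

end NavigationData

end Kropina

/-! ### Einstein implies Killing -/

namespace Kropina

open Finset TopologicalSpace smoothFun

namespace NavigationData

variable {n : ℕ} (L : NavigationData n)

/-- The Lie derivative of `h` along `W`. -/
noncomputable def lieForm (x : Coord n) (i j : Fin n) : ℝ :=
  ∑ k, (L.W x k * fderiv ℝ (fun u => L.h u i j) x (EuclideanSpace.single k 1)
    + L.h x k j * fderiv ℝ (fun u => L.W u k) x (EuclideanSpace.single i 1)
    + L.h x i k * fderiv ℝ (fun u => L.W u k) x (EuclideanSpace.single j 1))

theorem ev_lie (p : L.domain) (i j : Fin n) : ev p (L.datum.lie i j) = L.lieForm p.1.1 i j := by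
  simp only [KropinaDatum.lie, map_sum, map_add, map_mul, lieForm]
  refine sum_congr rfl fun k _ => ?_
  exact congrArg₂ (· + ·) (congrArg₂ (· + ·)
    (congrArg (L.W p.1.1 k * ·) (L.represents_fst (L.contDiffOn_h i j) k p).symm)
    (congrArg (L.h p.1.1 k j * ·) (L.represents_fst (L.contDiffOn_W k) i p).symm))
    (congrArg (L.h p.1.1 i k * ·) (L.represents_fst (L.contDiffOn_W k) j p).symm)

theorem ev_strain (p : L.domain) :
    2 * ev p L.datum.strain = bil (L.lieForm p.1.1) p.1.2.ofLp p.1.2.ofLp := by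
  have := congrArg (ev p) L.datum.two_mul_strain
  simp only [map_mul, map_ofNat, map_sum, ev_lie] at this
  exact this

theorem bil_lieForm_W {x : Coord n} (hx : x ∈ L.U) : bil (L.lieForm x) (L.W x) (L.W x) = 0 := by
  -- The identity lives over the half-space domain, so a point above x is needed; y = W serves
  -- because h(W,W) = 1 > 0.
  let p : L.domain := ⟨(x, WithLp.toLp 2 (L.W x)), hx, by rw [L.unit x hx]; exact one_pos⟩
  have := congrArg (ev p) L.datum.sum_lie_W
  simp only [map_mul, map_zero, map_sum, ev_lie] at this
  exact this

section Line

variable {L} {x : Coord n} (hx : x ∈ L.U) {X : Fin n → ℝ} (hX : bil (L.h x) (L.W x) X = 0)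

include hx hX in
theorem bil_W_line (t : ℝ) : bil (L.h x) (L.W x) (L.W x + t • X) = 1 := by
  rw [bil_add_right, bil_smul_right, hX, L.unit x hx]; ring

/-- The line through `W` in the direction `X` in the fibre of the domain over `x`, for `X`
orthogonal to `W`. -/
noncomputable def line (t : ℝ) : L.domain :=
  ⟨(x, WithLp.toLp 2 (L.W x + t • X)), hx, by
    change 0 < bil (L.h x) (L.W x) (L.W x + t • X)
    rw [bil_W_line hx hX]; exact one_pos⟩

/-- The line is vertical and stays in the domain for all t, so the derivative of c along it
vanishes. -/
theorem ev_line_const {c : smoothFun L.domain} (hc : ∀ k, L.datum.Y k c = 0) (t : ℝ) :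
    ev (line hx hX t) c = ev (line hx hX 0) c := by
  have hd : ∀ s : ℝ, HasDerivAt (fun s => ev (line hx hX s) c) 0 s := by
    intro s
    have h1 : HasDerivAt (fun s : ℝ => (x, WithLp.toLp 2 (L.W x + s • X)))
        ((0 : Coord n), WithLp.toLp 2 X) s := by
      refine (hasDerivAt_const s x).prodMk ?_
      have h2 : HasDerivAt (fun s : ℝ => WithLp.toLp 2 (L.W x) + s • WithLp.toLp 2 X)
          ((1 : ℝ) • WithLp.toLp 2 X) s :=
        ((hasDerivAt_id s).smul_const (WithLp.toLp 2 X)).const_add _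
      rw [one_smul] at h2
      exact h2
    have h3 := ((represents_extendZero c).differentiableAt (line hx hX s)).hasFDerivAt
    have h4 := h3.comp_hasDerivAt s h1
    have h5 : fderiv ℝ (extendZero L.domain c) (line hx hX s) (0, WithLp.toLp 2 X) = 0 := by
      have h6 : ((0 : Coord n), (WithLp.toLp 2 X : Coord n))
          = ∑ k, X k • ((0 : Coord n), (EuclideanSpace.single k 1 : Coord n)) := by
        refine Prod.ext (by simp [Prod.fst_sum]) ?_
        simp only [Prod.snd_sum, Prod.smul_snd]
        ext i
        simp [Finset.sum_apply, Pi.single_apply]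
      rw [h6, map_sum]
      refine sum_eq_zero fun k _ => ?_
      rw [map_smul]
      have := congrArg (ev (line hx hX s)) (hc k)
      rw [map_zero] at this
      change fderiv ℝ (extendZero L.domain c) (line hx hX s) (0, EuclideanSpace.single k 1) = 0
        at this
      rw [this, smul_zero]
    rw [h5] at h4
    refine h4.congr_of_eventuallyEq (Filter.Eventually.of_forall fun r => ?_)
    exact (represents_extendZero c (line hx hX r)).symm
  exact is_const_of_deriv_eq_zero (fun s => (hd s).differentiableAt) (fun s => (hd s).deriv) t 0

/-- On the line fibrewise constants are constant, fibre coordinates are affine in t, and `βInv` is 1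
because β is 1; these generate `regular`. -/
theorem exists_polynomial_line {f : smoothFun L.domain} (hf : f ∈ L.datum.regular) :
    ∃ P : Polynomial ℝ, ∀ t, ev (line hx hX t) f = P.eval t := by
  induction hf using Algebra.adjoin_induction with
  | mem f hf =>
    rcases hf with (hf | ⟨i, rfl⟩) | hf
    · exact ⟨Polynomial.C (ev (line hx hX 0) f), fun t => by
        rw [ev_line_const hx hX hf t, Polynomial.eval_C]⟩
    · refine ⟨Polynomial.C (L.W x i) + Polynomial.X * Polynomial.C (X i), fun t => ?_⟩
      simp only [Polynomial.eval_add, Polynomial.eval_C, Polynomial.eval_mul, Polynomial.eval_X]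
      rfl
    · refine ⟨1, fun t => ?_⟩
      have := congrArg (ev (line hx hX t)) L.datum.mul_βInv
      rw [map_mul, map_one, ev_β] at this
      change bil (L.h x) (L.W x) (L.W x + t • X) * _ = 1 at this
      rw [bil_W_line hx hX, one_mul] at this
      rw [Set.mem_singleton_iff.1 hf, this, Polynomial.eval_one]
  | algebraMap r => exact ⟨Polynomial.C r, fun t => by
      rw [Polynomial.eval_C, AlgHom.commutes]; rfl⟩
  | add f g _ _ hf hg =>
    obtain ⟨P, hP⟩ := hf
    obtain ⟨Q, hQ⟩ := hg
    exact ⟨P + Q, fun t => by rw [map_add, hP, hQ, Polynomial.eval_add]⟩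
  | mul f g _ _ hf hg =>
    obtain ⟨P, hP⟩ := hf
    obtain ⟨Q, hQ⟩ := hg
    exact ⟨P * Q, fun t => by rw [map_mul, hP, hQ, Polynomial.eval_mul]⟩

end Line

/-- The polynomial identity persists over ℂ. At the root i/√s of 1 + s t² the squared quadratic
vanishes, and the real and imaginary parts give the two relations. -/
theorem _root_.Polynomial.quadratic_of_sq_eq_mul {a b c m s : ℝ} (hm : m ≠ 0) (hs : 0 < s)
    (P : Polynomial ℝ)
    (h : ∀ t : ℝ, m * (a + b * t + c * t ^ 2) ^ 2 = (1 + s * t ^ 2) * P.eval t) :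
    a * s = c ∧ b = 0 := by
  open Polynomial in
  have h1 : C m * (C a + C b * X + C c * X ^ 2) ^ 2 = (1 + C s * X ^ 2) * P :=
    Polynomial.funext fun t => by simpa using h t
  set z : ℂ := Complex.I / (Real.sqrt s : ℝ) with hz
  have hs' : (Real.sqrt s : ℝ) ≠ 0 := (Real.sqrt_pos.2 hs).ne'
  have hsz : (s : ℂ) * z ^ 2 = -1 := by
    rw [hz, div_pow, Complex.I_sq, ← Complex.ofReal_pow, Real.sq_sqrt hs.le]
    have : (s : ℂ) ≠ 0 := Complex.ofReal_ne_zero.2 hs.ne'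
    field_simp
  have h2 := congrArg (Polynomial.aeval z) h1
  simp only [map_mul, map_pow, map_add, Polynomial.aeval_C, Polynomial.aeval_X, map_one,
    Complex.coe_algebraMap, hsz, add_neg_cancel, zero_mul] at h2
  have h3 : (a : ℂ) + b * z + c * z ^ 2 = 0 := by
    simpa [hm] using h2
  have h4 : ((a * s - c : ℝ) : ℂ) + ((b * Real.sqrt s : ℝ) : ℂ) * Complex.I = 0 := by
    have h5 : (s : ℂ) * z = (Real.sqrt s : ℝ) * Complex.I := by
      rw [hz]
      nth_rewrite 1 [← Real.mul_self_sqrt hs.le]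
      have : ((Real.sqrt s : ℝ) : ℂ) ≠ 0 := Complex.ofReal_ne_zero.2 hs'
      push_cast
      field_simp
    push_cast
    linear_combination (s : ℂ) * h3 - c * hsz - b * h5
  have hre := congrArg Complex.re h4
  have him := congrArg Complex.im h4
  simp only [Complex.add_re, Complex.ofReal_re, Complex.mul_re, Complex.I_re, Complex.ofReal_im,
    Complex.I_im, Complex.add_im, Complex.mul_im, Complex.zero_re, Complex.zero_im] at hre him
  refine ⟨by linarith, ?_⟩
  have : b * Real.sqrt s = 0 := by linarith
  exact (mul_eq_zero.1 this).resolve_right hs'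

variable {L} {F : Coord n → Coord n → ℝ}

/-- If the Kropina metric with navigation data `(h, W)` is Einstein, then `W` is a Killing field
of `h`. -/
theorem IsMetric.killing (hn : 2 ≤ n) (hF : L.IsMetric F) {σ : Coord n → ℝ}
    (hE : ∀ x ∈ L.U, ∀ v : Coord n, 0 < bil (L.h x) (L.W x) v.ofLp →
      ricciCurvature F x v = σ x * F x v ^ 2)
    {x : Coord n} (hx : x ∈ L.U) (v : Fin n → ℝ) : bil (L.lieForm x) v v = 0 := by
  have hperp : ∀ X : Fin n → ℝ, bil (L.h x) (L.W x) X = 0 → ∀ c : ℝ,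
      bil (L.lieForm x) (c • L.W x + X) (c • L.W x + X) = 0 := by
    intro X hX c
    have hWW := L.bil_lieForm_W hx
    rcases eq_or_ne X 0 with rfl | hX0
    · simp only [add_zero, bil_smul_left, bil_smul_right, hWW, mul_zero]
    set s := bil (L.h x) X X with hs
    have hspos : 0 < s := L.pos x hx X hX0
    have hexp : ∀ (a : Fin n → Fin n → ℝ) (c t : ℝ),
        bil a (c • L.W x + t • X) (c • L.W x + t • X) = c ^ 2 * bil a (L.W x) (L.W x)
          + c * (bil a (L.W x) X + bil a X (L.W x)) * t + bil a X X * t ^ 2 := by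
      intro a c t
      simp only [bil_add_left, bil_add_right, bil_smul_left, bil_smul_right]
      ring
    obtain ⟨T, hT, hric⟩ := L.datum.ricci_geod
    obtain ⟨P, hP⟩ := exists_polynomial_line hx hX hT
    have hhyy : ∀ t, ev (line hx hX t) L.datum.hyy = 1 + s * t ^ 2 := by
      intro t
      rw [ev_hyy]
      change bil (L.h x) (L.W x + t • X) (L.W x + t • X) = _
      have := hexp (L.h x) 1 t
      rw [one_smul] at this
      rw [this, bil_comm (L.symm x hx) X, hX, L.unit x hx, ← hs]
      ring
    have hβ : ∀ t, ev (line hx hX t) L.datum.β = 1 := by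
      intro t
      rw [ev_β]
      exact bil_W_line hx hX t
    have hFt : ∀ t, ev (line hx hX t) L.datum.F = 1 + s * t ^ 2 := by
      intro t
      rw [← hhyy, ← L.datum.F_mul_β, map_mul, hβ, mul_one]
    have hstrain : ∀ t, 2 * ev (line hx hX t) L.datum.strain
        = bil (L.lieForm x) (L.W x) (L.W x)
          + (bil (L.lieForm x) (L.W x) X + bil (L.lieForm x) X (L.W x)) * t
          + bil (L.lieForm x) X X * t ^ 2 := by
      intro t
      rw [ev_strain]
      change bil (L.lieForm x) (L.W x + t • X) (L.W x + t • X) = _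
      have := hexp (L.lieForm x) 1 t
      rw [one_smul] at this
      rw [this]
      ring
    have hRic : ∀ t, ev (line hx hX t) (L.datum.ricci L.datum.geod)
        = σ x * (1 + s * t ^ 2) ^ 2 := by
      intro t
      have h1 : ricciCurvature F x _ = _ := represents_ricci hF.represents_geod (line hx hX t)
      have h2 : F x _ = _ := hF.represents (line hx hX t)
      have h3 := hE x hx _ (line hx hX t).2.2
      refine h1.symm.trans (h3.trans ?_)
      rw [h2, hFt]
    -- The 4 appears because the quadratic polynomial in t is twice `strain`; n ≥ 2 keeps the pole
    -- from disappearing.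
    have hm : (3 * ((n : ℝ) - 1)) / 4 ≠ 0 := by
      have : (2 : ℝ) ≤ n := by exact_mod_cast hn
      have : 0 < (n : ℝ) - 1 := by linarith
      positivity
    open Polynomial in
    have key := Polynomial.quadratic_of_sq_eq_mul hm hspos
      -- On the line F = h(y,y) = 1 + s t², so h(y,y)² Ric = σ (1 + s t²)⁴; one factor is taken out
      -- to match the remainder h(y,y) T of `ricci_geod`.
      (C (σ x) * (1 + C s * Polynomial.X ^ 2) ^ 3 - P) fun t => by
        have h1 := congrArg (ev (line hx hX t)) hric
        simp only [map_mul, map_pow, map_add, map_sub, map_natCast, map_ofNat, map_one, hhyy,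
          hβ, hRic, hP] at h1
        rw [← hstrain]
        simp only [eval_sub, eval_mul, eval_pow, eval_add, eval_C, eval_X, eval_one]
        linear_combination -h1
    have h1 := hexp (L.lieForm x) c 1
    rw [one_smul] at h1
    rw [h1, key.2, ← key.1, hWW]
    ring
  have hdec : v = bil (L.h x) (L.W x) v • L.W x + (v - bil (L.h x) (L.W x) v • L.W x) := by simp
  rw [hdec]
  refine hperp _ ?_ _
  rw [sub_eq_add_neg, ← neg_smul, bil_add_right, bil_smul_right, L.unit x hx]
  ring

end NavigationData

end Kropina

/-! ### Navigation data of a Kropina space in a chart -/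

namespace Kropina

open Finset TopologicalSpace smoothFun

/-- A Riemannian metric `a` and a nowhere vanishing 1-form `b` can be rescaled simultaneously so
that `b` becomes the dual of a unit vector field. -/
theorem exists_navigationData {n : ℕ} (U : Opens (Coord n)) (a : Coord n → Fin n → Fin n → ℝ)
    (b : Coord n → Fin n → ℝ) (ha : ∀ i j, ContDiffOn ℝ ∞ (fun x => a x i j) U)
    (hb : ∀ i, ContDiffOn ℝ ∞ (fun x => b x i) U)
    (hsymm : ∀ x ∈ U, ∀ i j, a x i j = a x j i)
    (hpos : ∀ x ∈ U, ∀ v, v ≠ 0 → 0 < bil (a x) v v) (hb0 : ∀ x ∈ U, b x ≠ 0) :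
    ∃ L : NavigationData n, L.U = U ∧ ∃ N : Coord n → ℝ, ∀ x ∈ U, 0 < N x ∧
      (∀ u v, bil (L.h x) u v = bil (a x) u v / N x) ∧
      ∀ v, bil (L.h x) (L.W x) v = (∑ i, b x i * v i) / N x := by
  let A : Matrix (Fin n) (Fin n) (smoothFun U) :=
    Matrix.of fun i j => smoothFun.mk (fun x => a x i j) (ha i j)
  have hdet : IsUnit A.det := isUnit_det_of_pos fun p v hv => hpos p.1 p.2 v hv
  let b' : Fin n → smoothFun U := fun i => smoothFun.mk (fun x => b x i) (hb i)
  let W' : Fin n → smoothFun U := Matrix.mulVec A⁻¹ b'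
  have hAW : Matrix.mulVec A W' = b' := by
    rw [Matrix.mulVec_mulVec, Matrix.mul_nonsing_inv _ hdet, Matrix.one_mulVec]
  let W : Coord n → Fin n → ℝ := fun x i => extendZero U (W' i) x
  have hW : ∀ i, ContDiffOn ℝ ∞ (fun x => W x i) U := fun i => (W' i).2
  have hlow : ∀ x ∈ U, ∀ i, ∑ j, a x i j * W x j = b x i := by
    intro x hx i
    have h1 := congrArg (ev ⟨x, hx⟩) (congrFun hAW i)
    simp only [Matrix.mulVec, dotProduct, map_sum, map_mul] at h1
    refine Eq.trans (sum_congr rfl fun j _ => ?_) h1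
    exact congrArg (a x i j * ·) (represents_extendZero (W' j) ⟨x, hx⟩)
  have hbil : ∀ x ∈ U, ∀ v, bil (a x) (W x) v = ∑ i, b x i * v i := by
    intro x hx v
    rw [bil_comm (hsymm x hx)]
    simp only [bil, ← hlow x hx, sum_mul]
    exact sum_congr rfl fun i _ => sum_congr rfl fun j _ => by ring
  -- The squared length a(W,W); dividing a by it makes W a unit vector, and b/N is then dual to W.
  let N : Coord n → ℝ := fun x => ∑ i, b x i * W x i
  have hNpos : ∀ x ∈ U, 0 < N x := by
    intro x hx
    change 0 < ∑ i, b x i * W x i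
    rw [← hbil x hx]
    refine hpos x hx _ fun h0 => hb0 x hx ?_
    ext i
    rw [← hlow x hx i, h0]
    simp
  have hNs : ContDiffOn ℝ ∞ N U := ContDiffOn.sum fun i _ => (hb i).mul (hW i)
  have hscale : ∀ x u v, bil (fun i j => a x i j / N x) u v = bil (a x) u v / N x := by
    intro x u v
    simp only [bil, sum_div]
    exact sum_congr rfl fun i _ => sum_congr rfl fun j _ => by ring
  let L : NavigationData n :=
    { U := U
      h := fun x i j => a x i j / N x
      W := W
      contDiffOn_h := fun i j => (ha i j).div hNs fun x hx => (hNpos x hx).ne'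
      contDiffOn_W := hW
      symm := fun x hx i j => by rw [hsymm x hx]
      pos := fun x hx v hv => by rw [hscale]; exact div_pos (hpos x hx v hv) (hNpos x hx)
      unit := fun x hx => by rw [hscale, hbil x hx]; exact div_self (hNpos x hx).ne' }
  refine ⟨L, rfl, N, fun x hx => ⟨hNpos x hx, hscale x, fun v => ?_⟩⟩
  change bil (fun i j => a x i j / N x) (W x) v = _
  rw [hscale, hbil x hx]

section Manifold

variable {n : ℕ} {M : Type*} [TopologicalSpace M] [ChartedSpace (Coord n) M]
  {e : OpenPartialHomeomorph M (Coord n)}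

theorem coordVector_ne_zero (he : e ∈ IsManifold.maximalAtlas 𝓘(ℝ, Coord n) ∞ M) {u : Coord n}
    (hu : u ∈ e.target) {v : Coord n} (hv : v ≠ 0) : coordVector e u v ≠ 0 := by
  have hd : e.MDifferentiable 𝓘(ℝ, Coord n) 𝓘(ℝ, Coord n) :=
    ⟨(contMDiffOn_of_mem_maximalAtlas he).mdifferentiableOn (by simp),
      (contMDiffOn_symm_of_mem_maximalAtlas he).mdifferentiableOn (by simp)⟩
  have := hd.symm.mfderiv_injective hu
  exact fun h0 => hv (this (h0.trans (map_zero _).symm))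

theorem exists_coordVector_eq (he : e ∈ IsManifold.maximalAtlas 𝓘(ℝ, Coord n) ∞ M) {u : Coord n}
    (hu : u ∈ e.target) (w : TangentSpace 𝓘(ℝ, Coord n) (e.symm u)) :
    ∃ v, coordVector e u v = w := by
  have hd : e.MDifferentiable 𝓘(ℝ, Coord n) 𝓘(ℝ, Coord n) :=
    ⟨(contMDiffOn_of_mem_maximalAtlas he).mdifferentiableOn (by simp),
      (contMDiffOn_symm_of_mem_maximalAtlas he).mdifferentiableOn (by simp)⟩
  exact hd.symm.mfderiv_surjective hu w

theorem coordVector_eq_sum (e : OpenPartialHomeomorph M (Coord n)) (u v : Coord n) :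
    coordVector e u v = ∑ i, v i • coordVector e u (EuclideanSpace.single i 1) := by
  have h : v = ∑ i, v i • (EuclideanSpace.single i 1 : Coord n) := by
    ext j
    simp [Finset.sum_apply, Pi.single_apply]
  obtain ⟨T, hT⟩ : ∃ T : Coord n →L[ℝ] TangentSpace 𝓘(ℝ, Coord n) (e.symm u),
      ∀ v, coordVector e u v = T v := ⟨_, fun _ => rfl⟩
  simp only [hT]
  conv_lhs => rw [h]
  simp only [map_sum, map_smul]

variable [IsManifold 𝓘(ℝ, Coord n) ∞ M]

/-- The field is the tangent map of `e.symm` applied to a constant section of the tangent bundle of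
the coordinate space. -/
theorem contMDiffOn_coordVector (he : e ∈ IsManifold.maximalAtlas 𝓘(ℝ, Coord n) ∞ M)
    (v : Coord n) :
    ContMDiffOn 𝓘(ℝ, Coord n) (𝓘(ℝ, Coord n).prod 𝓘(ℝ, Coord n)) ∞
      (fun u => Bundle.TotalSpace.mk' (Coord n) (E := fun x : M => TangentSpace 𝓘(ℝ, Coord n) x)
        (e.symm u) (coordVector e u v)) e.target := by
  have h1 := (contMDiffOn_symm_of_mem_maximalAtlas he).contMDiffOn_tangentMapWithin
    (m := ∞) (by simp) e.open_target.uniqueMDiffOn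
  have h2 : ContMDiff 𝓘(ℝ, Coord n) (𝓘(ℝ, Coord n).prod 𝓘(ℝ, Coord n)) ∞
      (fun u : Coord n => (⟨u, v⟩ : TangentBundle 𝓘(ℝ, Coord n) (Coord n))) :=
    contMDiff_vectorSpace_iff_contDiff.2 contDiff_const
  refine (h1.comp (t := _) h2.contMDiffOn fun u hu => hu).congr fun u hu => ?_
  simp only [Function.comp, tangentMapWithin, coordVector]
  rw [mfderivWithin_of_isOpen e.open_target hu]

namespace KropinaSpace

variable (K : KropinaSpace n M)

theorem contDiffOn_inner (he : e ∈ IsManifold.maximalAtlas 𝓘(ℝ, Coord n) ∞ M) (v w : Coord n) :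
    ContDiffOn ℝ ∞ (fun u => K.α.inner (e.symm u) (coordVector e u v) (coordVector e u w))
      e.target := by
  rw [← contMDiffOn_iff_contDiffOn]
  intro u hu
  have : ContMDiffWithinAt 𝓘(ℝ, Coord n) (𝓘(ℝ, Coord n).prod 𝓘(ℝ)) ∞
      (fun u ↦ Bundle.TotalSpace.mk' ℝ (E := Bundle.Trivial M ℝ) (e.symm u)
        (K.α.inner (e.symm u) (coordVector e u v) (coordVector e u w))) e.target u := by
    apply ContMDiffWithinAt.clm_bundle_apply₂ (F₁ := Coord n) (F₂ := Coord n)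
    · exact K.α.contMDiff.contMDiffAt.comp_contMDiffWithinAt u
        (contMDiffOn_symm_of_mem_maximalAtlas he u hu)
    · exact contMDiffOn_coordVector he v u hu
    · exact contMDiffOn_coordVector he w u hu
  simp only [Bundle.contMDiffWithinAt_totalSpace] at this
  exact this.2

theorem contDiffOn_form (he : e ∈ IsManifold.maximalAtlas 𝓘(ℝ, Coord n) ∞ M) (v : Coord n) :
    ContDiffOn ℝ ∞ (fun u => (K.β (e.symm u) (coordVector e u v) : ℝ)) e.target := by
  rw [← contMDiffOn_iff_contDiffOn]
  intro u hu
  have : ContMDiffWithinAt 𝓘(ℝ, Coord n) (𝓘(ℝ, Coord n).prod 𝓘(ℝ)) ∞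
      (fun u ↦ Bundle.TotalSpace.mk' ℝ (E := Bundle.Trivial M ℝ) (e.symm u)
        (K.β (e.symm u) (coordVector e u v))) e.target u := by
    apply ContMDiffWithinAt.clm_bundle_apply (F₁ := Coord n)
    · exact K.contMDiff_β.contMDiffAt.comp_contMDiffWithinAt u
        (contMDiffOn_symm_of_mem_maximalAtlas he u hu)
    · exact contMDiffOn_coordVector he v u hu
  simp only [Bundle.contMDiffWithinAt_totalSpace] at this
  exact this.2

/-- The navigation data of a Kropina space in local coordinates. -/
theorem exists_navigationData (he : e ∈ IsManifold.maximalAtlas 𝓘(ℝ, Coord n) ∞ M) :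
    ∃ L : NavigationData n, (L.U : Set (Coord n)) = e.target ∧ ∀ u ∈ e.target, ∀ v : Coord n,
      (coordVector e u v ∈ K.domain (e.symm u) ↔ 0 < bil (L.h u) (L.W u) v.ofLp) ∧
      K.coordF e u v = bil (L.h u) v.ofLp v.ofLp / bil (L.h u) (L.W u) v.ofLp := by
  let E : Fin n → Coord n := fun i => EuclideanSpace.single i 1
  let a : Coord n → Fin n → Fin n → ℝ := fun u i j =>
    K.α.inner (e.symm u) (coordVector e u (E i)) (coordVector e u (E j))
  let b : Coord n → Fin n → ℝ := fun u i => K.β (e.symm u) (coordVector e u (E i))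
  have ha : ∀ u (v w : Coord n), K.α.inner (e.symm u) (coordVector e u v) (coordVector e u w)
      = bil (a u) v.ofLp w.ofLp := by
    intro u v w
    rw [coordVector_eq_sum e u v, coordVector_eq_sum e u w]
    simp only [map_sum, map_smul, _root_.sum_apply, smul_apply, smul_eq_mul, bil, mul_sum]
    rw [sum_comm]
    exact sum_congr rfl fun i _ => sum_congr rfl fun j _ => by
      change _ = K.α.inner _ (coordVector e u (EuclideanSpace.single i 1))
        (coordVector e u (EuclideanSpace.single j 1)) * _ * _
      ring
  have hb : ∀ u (v : Coord n), (K.β (e.symm u) (coordVector e u v) : ℝ)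
      = ∑ i, b u i * v.ofLp i := by
    intro u v
    rw [coordVector_eq_sum e u v, map_sum]
    refine sum_congr rfl fun i _ => ?_
    rw [map_smul]
    exact mul_comm _ _
  obtain ⟨L, hLU, N, hN⟩ := Kropina.exists_navigationData ⟨e.target, e.open_target⟩ a b
    (fun i j => K.contDiffOn_inner he _ _) (fun i => K.contDiffOn_form he _)
    (fun u hu i j => K.α.symm _ _ _)
    (fun u hu v hv => by
      have := K.α.pos _ _ (coordVector_ne_zero he hu (v := WithLp.toLp 2 v)
        fun h0 => hv (congrArg WithLp.ofLp h0))
      rwa [ha] at this)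
    (fun u hu h0 => K.β_ne_zero (e.symm u) <| by
      ext w
      obtain ⟨v, rfl⟩ := exists_coordVector_eq he hu w
      refine (hb u v).trans ?_
      rw [h0]
      simp)
  refine ⟨L, by rw [hLU]; rfl, fun u hu v => ?_⟩
  obtain ⟨h1, h2, h3⟩ := hN u hu
  constructor
  · rw [h3, div_pos_iff_of_pos_right h1, ← hb]
    rfl
  · rw [h2, h3, div_div_div_cancel_right₀ h1.ne', ← ha, ← hb]
    rfl

end KropinaSpace

end Manifold

end Kropina

/-! ### Proportional Kropina metrics with Killing navigation fields -/

namespace Kropina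

open Finset TopologicalSpace

/-- Two pairs of a Euclidean metric and a unit vector whose Kropina functions are proportional on
the half-space of the first one are related by a scaling. -/
theorem scaling_of_kropina_proportional {n : ℕ} {a a' : Fin n → Fin n → ℝ} {W W' : Fin n → ℝ}
    (ha : ∀ i j, a i j = a j i) (ha' : ∀ i j, a' i j = a' j i)
    (hpos : ∀ v, v ≠ 0 → 0 < bil a v v) (hW : bil a W W = 1) (hW' : bil a' W' W' = 1)
    {ψ : ℝ} (hψ : 0 < ψ) (hdom : ∀ v, 0 < bil a W v → 0 < bil a' W' v)
    (hF : ∀ v, 0 < bil a W v → bil a' v v / bil a' W' v = ψ * (bil a v v / bil a W v)) :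
    (∀ u v, bil a' u v = ψ ^ 2 * bil a u v) ∧ W = ψ • W' ∧ ψ = bil a' W' W := by
  -- The line W + t v stays in the first half-space, so an affine function of t is positive on all
  -- of ℝ; its slope must vanish.
  have hker : ∀ v, bil a W v = 0 → bil a' W' v = 0 := by
    intro v hv
    have h1 : ∀ t : ℝ, 0 < bil a' W' W + t * bil a' W' v := by
      intro t
      rw [← bil_smul_right, ← bil_add_right]
      refine hdom _ ?_
      rw [bil_add_right, bil_smul_right, hv, hW]
      norm_num
    by_contra hne
    have h2 := h1 (-bil a' W' W / bil a' W' v)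
    rw [div_mul_cancel₀ _ hne] at h2
    linarith
  set μ := bil a' W' W with hμ
  have hμpos : 0 < μ := hdom W (by rw [hW]; exact one_pos)
  have hω : ∀ v, bil a' W' v = μ * bil a W v := by
    intro v
    have h1 := hker (v + (-bil a W v) • W) (by rw [bil_add_right, bil_smul_right, hW]; ring)
    rw [bil_add_right, bil_smul_right, ← hμ] at h1
    linarith
  have h1 : ∀ v, 0 < bil a W v → bil a' v v = ψ * μ * bil a v v := by
    intro v hv
    have := hF v hv
    rw [hω, div_eq_iff (by positivity)] at this
    rw [this]
    field_simp
  -- The hypothesis covers only an open half-space. Evenness handles the opposite one, and on the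
  -- hyperplane v is recovered from W + v and W - v by the parallelogram identity.
  have hquad : ∀ v, bil a' v v = ψ * μ * bil a v v := by
    intro v
    have hneg : ∀ b : Fin n → Fin n → ℝ, bil b ((-1 : ℝ) • v) ((-1 : ℝ) • v) = bil b v v := by
      intro b
      rw [bil_smul_left, bil_smul_right]; ring
    rcases lt_trichotomy (bil a W v) 0 with hv | hv | hv
    · have := h1 ((-1 : ℝ) • v) (by rw [bil_smul_right]; linarith)
      rwa [hneg, hneg] at this
    · have e1 := h1 (W + v) (by rw [bil_add_right, hW, hv]; norm_num)
      have e2 := h1 (W + (-1 : ℝ) • v) (by rw [bil_add_right, bil_smul_right, hW, hv]; norm_num)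
      have e3 := h1 W (by rw [hW]; exact one_pos)
      simp only [bil_add_left, bil_add_right, bil_smul_left, bil_smul_right] at e1 e2
      linarith
    · exact h1 v hv
  have hbil : ∀ u v, bil a' u v = ψ * μ * bil a u v := by
    intro u v
    have := hquad (u + v)
    simp only [bil_add_left, bil_add_right] at this
    rw [hquad, hquad, bil_comm ha' v u, bil_comm ha v u] at this
    linarith
  have hWW : W = ψ • W' := by
    by_contra hne
    have h2 : ∀ v, bil a (W + (-ψ) • W') v = 0 := by
      intro v
      rw [bil_add_left, bil_smul_left]
      have := hω v
      rw [hbil] at this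
      have h3 : μ * (bil a W v + -ψ * bil a W' v) = 0 := by linarith
      exact (mul_eq_zero.1 h3).resolve_left hμpos.ne'
    refine (hpos (W + (-ψ) • W') fun h0 => hne ?_).ne' (h2 _)
    rw [neg_smul, ← sub_eq_add_neg, sub_eq_zero] at h0
    exact h0
  -- Pair W = ψ W' with the unit vector W'.
  have hψμ : ψ = μ := by
    have := bil_smul_right a' ψ W' W'
    rw [← hWW, hW', mul_one] at this
    exact this.symm
  refine ⟨fun u v => ?_, hWW, hψμ⟩
  rw [hbil, ← hψμ]; ring

/-- A vector orthogonal to a given one in dimension at least two. -/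
theorem exists_ne_zero_bil_eq_zero {n : ℕ} (hn : 2 ≤ n) (a : Fin n → Fin n → ℝ)
    (W : Fin n → ℝ) : ∃ v, v ≠ 0 ∧ bil a W v = 0 := by
  let T : (Fin n → ℝ) →ₗ[ℝ] ℝ :=
    { toFun := bil a W
      map_add' := bil_add_right a W
      map_smul' := fun c v => bil_smul_right a c W v }
  have : LinearMap.ker T ≠ ⊥ := LinearMap.ker_ne_bot_of_finrank_lt (by simp; omega)
  obtain ⟨v, hv, hv0⟩ := (Submodule.ne_bot_iff _).1 this
  exact ⟨v, hv0, hv⟩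

namespace NavigationData

variable {n : ℕ} {L L' : NavigationData n}

/-- If the navigation data `(h, W)` and `(ψ² h, ψ⁻¹ W)` both consist of a metric and a Killing
field, then `ψ` has vanishing derivative. -/
theorem fderiv_eq_zero_of_killing (hn : 2 ≤ n) {V : Set (Coord n)} (hV : IsOpen V)
    (hVL : V ⊆ L.U) (hVL' : V ⊆ L'.U) {ψ : Coord n → ℝ}
    (hh : ∀ x ∈ V, ∀ i j, L'.h x i j = ψ x ^ 2 * L.h x i j)
    (hW : ∀ x ∈ V, L.W x = ψ x • L'.W x) (hψd : DifferentiableOn ℝ ψ V)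
    (hL : ∀ x ∈ V, ∀ v, bil (L.lieForm x) v v = 0)
    (hL' : ∀ x ∈ V, ∀ v, bil (L'.lieForm x) v v = 0) {x : Coord n} (hx : x ∈ V) :
    fderiv ℝ ψ x = 0 := by
  have hVx : V ∈ nhds x := hV.mem_nhds hx
  have hψx : DifferentiableAt ℝ ψ x := (hψd x hx).differentiableAt hVx
  have hhx : ∀ i j, DifferentiableAt ℝ (fun u => L.h u i j) x := fun i j =>
    ((L.contDiffOn_h i j).contDiffAt (L.U.isOpen.mem_nhds (hVL hx))).differentiableAt (by simp)
  have hWx : ∀ i, DifferentiableAt ℝ (fun u => L'.W u i) x := fun i =>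
    ((L'.contDiffOn_W i).contDiffAt (L'.U.isOpen.mem_nhds (hVL' hx))).differentiableAt (by simp)
  set d : Fin n → ℝ := fun k => fderiv ℝ ψ x (EuclideanSpace.single k 1) with hd
  have dh : ∀ i j k, fderiv ℝ (fun u => L'.h u i j) x (EuclideanSpace.single k 1)
      = 2 * ψ x * d k * L.h x i j
        + ψ x ^ 2 * fderiv ℝ (fun u => L.h u i j) x (EuclideanSpace.single k 1) := by
    intro i j k
    have e : (fun u => L'.h u i j) =ᶠ[nhds x] fun u => ψ u ^ 2 * L.h u i j :=
      Filter.eventually_of_mem hVx fun u hu => hh u hu i j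
    have e' : HasFDerivAt (fun u => ψ u ^ 2 * L.h u i j) _ x :=
      (hψx.hasFDerivAt.pow 2).mul (hhx i j).hasFDerivAt
    rw [e.fderiv_eq, e'.fderiv]
    simp [hd]
    ring
  have dW : ∀ i k, fderiv ℝ (fun u => L.W u i) x (EuclideanSpace.single k 1)
      = d k * L'.W x i + ψ x * fderiv ℝ (fun u => L'.W u i) x (EuclideanSpace.single k 1) := by
    intro i k
    have e : (fun u => L.W u i) =ᶠ[nhds x] fun u => ψ u * L'.W u i :=
      Filter.eventually_of_mem hVx fun u hu => by
        change L.W u i = _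
        rw [hW u hu]; rfl
    have e' : HasFDerivAt (fun u => ψ u * L'.W u i) _ x :=
      hψx.hasFDerivAt.mul (hWx i).hasFDerivAt
    rw [e.fderiv_eq, e'.fderiv]
    simp [hd]
    ring
  have hWi : ∀ i, L.W x i = ψ x * L'.W x i := fun i => by rw [hW x hx]; rfl
  -- The Leibniz rule for L_{W/ψ}(ψ² h), with the derivative of W rewritten through that of W' to
  -- avoid dividing by ψ.
  have hlie : ∀ i j, L'.lieForm x i j = ψ x * L.lieForm x i j
      + 2 * (∑ k, L.W x k * d k) * L.h x i j
      - d i * (∑ k, L.h x k j * L.W x k) - d j * ∑ k, L.h x i k * L.W x k := by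
    intro i j
    simp only [lieForm, mul_sum, sum_mul, ← sum_add_distrib, ← sum_sub_distrib]
    refine sum_congr rfl fun k _ => ?_
    rw [dh, dW, dW, hh x hx, hh x hx, hWi]
    ring
  have key : ∀ v, (∑ k, L.W x k * d k) * bil (L.h x) v v
      = (∑ k, d k * v k) * bil (L.h x) (L.W x) v := by
    intro v
    have e1 : bil (L'.lieForm x) v v = ψ x * bil (L.lieForm x) v v
        + 2 * (∑ k, L.W x k * d k) * bil (L.h x) v v
        - (∑ i, d i * v i) * (∑ j, (∑ k, L.h x k j * L.W x k) * v j)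
        - (∑ i, (∑ k, L.h x i k * L.W x k) * v i) * (∑ j, d j * v j) := by
      rw [sum_mul_sum, sum_mul_sum]
      simp only [bil, hlie]
      generalize ∑ k, L.W x k * d k = S
      simp only [mul_sum _ _ (ψ x), mul_sum _ _ (2 * S), ← sum_add_distrib, ← sum_sub_distrib]
      exact sum_congr rfl fun i _ => sum_congr rfl fun j _ => by ring
    have e2 : ∑ j, (∑ k, L.h x k j * L.W x k) * v j = bil (L.h x) (L.W x) v := by
      simp only [bil, sum_mul]
      rw [sum_comm]
    have e3 : ∑ i, (∑ k, L.h x i k * L.W x k) * v i = bil (L.h x) (L.W x) v := by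
      rw [← e2]
      exact sum_congr rfl fun i _ => by simp only [L.symm x (hVL hx) i]
    rw [e2, e3, hL x hx, hL' x hx] at e1
    linarith
  have hdW : ∑ k, L.W x k * d k = 0 := by
    obtain ⟨v, hv, hv0⟩ := exists_ne_zero_bil_eq_zero hn (L.h x) (L.W x)
    have := key v
    rw [hv0, mul_zero] at this
    exact (mul_eq_zero.1 this).resolve_right (L.pos x (hVL hx) v hv).ne'
  have hdv : ∀ v : Fin n → ℝ, ∑ k, d k * v k = 0 := by
    intro v
    have h1 : ∀ v : Fin n → ℝ, bil (L.h x) (L.W x) v ≠ 0 → ∑ k, d k * v k = 0 := by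
      intro v hv
      have := key v
      rw [hdW, zero_mul] at this
      exact (mul_eq_zero.1 this.symm).resolve_right hv
    -- A vector orthogonal to W leaves the hyperplane after adding W, which does not change dψ(v)
    -- because Wψ = 0.
    by_cases hv : bil (L.h x) (L.W x) v = 0
    · have h2 := h1 (v + L.W x) (by rw [bil_add_right, hv, L.unit x (hVL hx)]; norm_num)
      simp only [Pi.add_apply, mul_add, sum_add_distrib] at h2
      rw [sum_congr rfl fun k _ => mul_comm (d k) (L.W x k), hdW, add_zero] at h2
      exact h2
    · exact h1 v hv
  ext v
  have hv : v = ∑ i, v i • (EuclideanSpace.single i 1 : Coord n) := by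
    ext j
    simp [Finset.sum_apply, Pi.single_apply]
  rw [hv, map_sum]
  simp only [map_smul, smul_eq_mul]
  rw [sum_congr rfl fun k _ => mul_comm (v k) _]
  exact hdv v

/-- If two Kropina metrics with a common domain of definition have Killing navigation fields and
are proportional, then the factor has vanishing derivative. -/
theorem fderiv_factor_eq_zero (hn : 2 ≤ n) {V : Set (Coord n)} (hV : IsOpen V)
    (hVL : V ⊆ L.U) (hVL' : V ⊆ L'.U) {ψ : Coord n → ℝ} (hψ : ∀ x ∈ V, 0 < ψ x)
    (hdom : ∀ x ∈ V, ∀ v, 0 < bil (L.h x) (L.W x) v → 0 < bil (L'.h x) (L'.W x) v)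
    (hF : ∀ x ∈ V, ∀ v, 0 < bil (L.h x) (L.W x) v → bil (L'.h x) v v / bil (L'.h x) (L'.W x) v
      = ψ x * (bil (L.h x) v v / bil (L.h x) (L.W x) v))
    (hL : ∀ x ∈ V, ∀ v, bil (L.lieForm x) v v = 0)
    (hL' : ∀ x ∈ V, ∀ v, bil (L'.lieForm x) v v = 0) :
    DifferentiableOn ℝ ψ V ∧ ∀ x ∈ V, fderiv ℝ ψ x = 0 := by
  have hsc := fun x (hx : x ∈ V) => scaling_of_kropina_proportional (L.symm x (hVL hx))
    (L'.symm x (hVL' hx)) (L.pos x (hVL hx)) (L.unit x (hVL hx)) (L'.unit x (hVL' hx))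
    (hψ x hx) (hdom x hx) (hF x hx)
  have hψd : DifferentiableOn ℝ ψ V := by
    -- No regularity of ψ is assumed; it comes from the formula ψ = h'(W', W).
    have h1 : ContDiffOn ℝ ∞ (fun x => bil (L'.h x) (L'.W x) (L.W x)) V :=
      ContDiffOn.sum fun i _ => ContDiffOn.sum fun j _ =>
        (((L'.contDiffOn_h i j).mono hVL').mul ((L'.contDiffOn_W i).mono hVL')).mul
          ((L.contDiffOn_W j).mono hVL)
    exact (h1.differentiableOn (by simp)).congr fun x hx => (hsc x hx).2.2
  have hentry : ∀ (a : Fin n → Fin n → ℝ) i j, bil a (Pi.single i 1) (Pi.single j 1) = a i j := by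
    intro a i j
    simp [bil, Pi.single_apply]
  refine ⟨hψd, fun x hx => fderiv_eq_zero_of_killing hn hV hVL hVL' (fun x hx i j => ?_)
    (fun x hx => (hsc x hx).2.1) hψd hL hL' hx⟩
  rw [← hentry (L'.h x), ← hentry (L.h x), (hsc x hx).1]

end NavigationData

end Kropina

/-! ### Conformal maps in transported charts and the conclusion -/

namespace Kropina

variable {n : ℕ} {M : Type*} [TopologicalSpace M] [ChartedSpace (Coord n) M]
  {M' : Type*} [TopologicalSpace M'] [ChartedSpace (Coord n) M']
  [IsManifold 𝓘(ℝ, Coord n) ∞ M']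

/-- A chart of the source transported by a local diffeomorphism is a chart of the target. -/
theorem exists_transported_chart {f : M → M'} {x : M}
    (hf : IsLocalDiffeomorphAt 𝓘(ℝ, Coord n) 𝓘(ℝ, Coord n) ∞ f x)
    {e : OpenPartialHomeomorph M (Coord n)}
    (he : e ∈ IsManifold.maximalAtlas 𝓘(ℝ, Coord n) ∞ M) (hx : x ∈ e.source) :
    ∃ e' ∈ IsManifold.maximalAtlas 𝓘(ℝ, Coord n) ∞ M', e'.target ⊆ e.target ∧ e x ∈ e'.target ∧
      ∀ u ∈ e'.target, e'.symm u = f (e.symm u) ∧ ∀ v : Coord n, (coordVector e' u v : Coord n)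
        = mfderiv 𝓘(ℝ, Coord n) 𝓘(ℝ, Coord n) f (e.symm u) (coordVector e u v) := by
  obtain ⟨Φ, hxΦ, hfΦ⟩ := hf
  have hes := contMDiffOn_symm_of_mem_maximalAtlas he
  -- In the charts e and e ∘ Φ⁻¹ the map f is the identity, so both metrics become functions of the
  -- same coordinates.
  let e' := Φ.toOpenPartialHomeomorph.symm.trans e
  have htarget : ∀ u, u ∈ e'.target ↔ u ∈ e.target ∧ e.symm u ∈ Φ.source := fun u => Iff.rfl
  have hsymm : ∀ u, e'.symm u = Φ (e.symm u) := fun u => rfl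
  refine ⟨e', ?_, fun u hu => ((htarget u).1 hu).1,
    (htarget _).2 ⟨e.map_source hx, by rwa [e.left_inv hx]⟩, fun u hu => ?_⟩
  · refine OpenPartialHomeomorph.mem_maximalAtlas_of_contMDiffOn _ ?_ ?_
    · exact (contMDiffOn_of_mem_maximalAtlas he).comp
        (Φ.contMDiffOn_invFun.mono fun y hy => hy.1) fun y hy => hy.2
    · exact Φ.contMDiffOn_toFun.comp (hes.mono fun u hu => ((htarget u).1 hu).1)
        fun u hu => ((htarget u).1 hu).2
  · obtain ⟨hu1, hu2⟩ := (htarget u).1 hu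
    refine ⟨by rw [hsymm, hfΦ hu2], fun v => ?_⟩
    have hΦe : Φ =ᶠ[nhds (e.symm u)] f :=
      Filter.eventually_of_mem (Φ.open_source.mem_nhds hu2) fun y hy => (hfΦ hy).symm
    have h1 : MDifferentiableAt 𝓘(ℝ, Coord n) 𝓘(ℝ, Coord n) Φ (e.symm u) :=
      Φ.mdifferentiableAt (by simp) hu2
    have h2 : MDifferentiableAt 𝓘(ℝ, Coord n) 𝓘(ℝ, Coord n) e.symm u :=
      (hes.contMDiffAt (e.open_target.mem_nhds hu1)).mdifferentiableAt (by simp)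
    have h3 := mfderiv_comp u h1 h2
    rw [hΦe.mfderiv_eq] at h3
    exact congrArg (fun T : Coord n →L[ℝ] Coord n => T v) h3

variable [IsManifold 𝓘(ℝ, Coord n) ∞ M]

theorem KropinaSpace.IsEinstein.exists_killing {K : KropinaSpace n M} (hK : K.IsEinstein)
    (hn : 2 ≤ n) {e : OpenPartialHomeomorph M (Coord n)}
    (he : e ∈ IsManifold.maximalAtlas 𝓘(ℝ, Coord n) ∞ M) :
    ∃ L : NavigationData n, (L.U : Set (Coord n)) = e.target ∧
      (∀ u ∈ e.target, ∀ v : Coord n,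
        (coordVector e u v ∈ K.domain (e.symm u) ↔ 0 < bil (L.h u) (L.W u) v.ofLp) ∧
        K.coordF e u v = bil (L.h u) v.ofLp v.ofLp / bil (L.h u) (L.W u) v.ofLp) ∧
      ∀ u ∈ e.target, ∀ v, bil (L.lieForm u) v v = 0 := by
  obtain ⟨L, hLU, hL⟩ := K.exists_navigationData he
  obtain ⟨σ, hσ⟩ := hK
  have hmem : ∀ u, u ∈ L.U ↔ u ∈ e.target := fun u => by rw [← hLU]; rfl
  have hF : L.IsMetric (K.coordF e) := fun u hu v _ => (hL u ((hmem u).1 hu) v).2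
  refine ⟨L, hLU, hL, fun u hu v => hF.killing hn (σ := fun u => σ (e.symm u)) ?_
    ((hmem u).2 hu) v⟩
  intro u hu v hv
  have hu' := (hmem u).1 hu
  exact hσ e he u hu' v ((hL u hu' v).1.2 hv)

/-- Moves the base point between `e'.symm u` and `f (e.symm u)`, which are only propositionally
equal; all tangent spaces are modelled on the same `Coord n`. -/
theorem KropinaSpace.F_congr (K : KropinaSpace n M) {x y : M} (h : x = y) (v : Coord n) :
    K.F x v = K.F y v := by subst h; rfl

theorem KropinaSpace.domain_congr (K : KropinaSpace n M) {x y : M} (h : x = y) {v : Coord n}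
    (hv : v ∈ K.domain x) : v ∈ K.domain y := by subst h; exact hv

/-- The conformal factor of a conformal map between Einstein Kropina spaces is locally
constant. -/
theorem IsConformalMap.isLocallyConstant (hn : 2 ≤ n) {K : KropinaSpace n M}
    {K' : KropinaSpace n M'} (hK : K.IsEinstein) (hK' : K'.IsEinstein) {f : M → M'} {φ : M → ℝ}
    (hf : IsConformalMap K K' f φ) : IsLocallyConstant φ := by
  rw [IsLocallyConstant.iff_eventually_eq]
  intro x
  set e := chartAt (Coord n) x with he_def
  have he : e ∈ IsManifold.maximalAtlas 𝓘(ℝ, Coord n) ∞ M := IsManifold.chart_mem_maximalAtlas x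
  have hx : x ∈ e.source := mem_chart_source _ x
  obtain ⟨e', he', hsub, hxe', hcomp⟩ := exists_transported_chart (hf.isLocalDiffeomorph x) he hx
  obtain ⟨L, hLU, hL, hkill⟩ := hK.exists_killing hn he
  obtain ⟨L', hLU', hL', hkill'⟩ := hK'.exists_killing hn he'
  have hdom : ∀ u ∈ e'.target, ∀ v : Coord n, coordVector e u v ∈ K.domain (e.symm u) →
      coordVector e' u v ∈ K'.domain (e'.symm u) := by
    intro u hu v hv
    have h1 := hf.mem_domain _ _ hv
    rw [← (hcomp u hu).2 v] at h1
    exact K'.domain_congr (hcomp u hu).1.symm h1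
  have hF : ∀ u ∈ e'.target, ∀ v : Coord n, coordVector e u v ∈ K.domain (e.symm u) →
      K'.coordF e' u v = (φ (e.symm u))⁻¹ * K.coordF e u v := by
    intro u hu v hv
    have h1 := hf.map_F _ _ hv
    rw [← (hcomp u hu).2 v] at h1
    exact (K'.F_congr (hcomp u hu).1 _).trans h1
  obtain ⟨hd, hd0⟩ := NavigationData.fderiv_factor_eq_zero (L := L) (L' := L') hn e'.open_target
    (hsub.trans hLU.ge) hLU'.ge (ψ := fun u => (φ (e.symm u))⁻¹)
    (fun u _ => inv_pos.2 (hf.factor_pos _))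
    (fun u hu v hv => ((hL' u hu (WithLp.toLp 2 v)).1).1 <|
      hdom u hu _ ((hL u (hsub hu) (WithLp.toLp 2 v)).1.2 hv))
    (fun u hu v hv => by
      have h1 := hF u hu _ ((hL u (hsub hu) (WithLp.toLp 2 v)).1.2 hv)
      rwa [(hL u (hsub hu) _).2, (hL' u hu _).2] at h1)
    (fun u hu v => hkill u (hsub hu) v) hkill'
  -- A vanishing derivative gives constancy only on a connected set, so a ball is chosen inside the
  -- chart.
  obtain ⟨r, hr, hball⟩ := Metric.isOpen_iff.1 e'.open_target _ hxe'
  have hconst : ∀ u ∈ Metric.ball (e x) r, φ (e.symm u) = φ x := by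
    intro u hu
    have h1 := Metric.isOpen_ball.is_const_of_fderiv_eq_zero
      (convex_ball (e x) r).isPreconnected (hd.mono hball) (fun y hy => hd0 y (hball hy)) hu
      (Metric.mem_ball_self hr)
    have h2 := inv_injective h1
    rwa [e.left_inv hx] at h2
  have hcont := e.continuousAt hx (Metric.ball_mem_nhds (e x) hr)
  filter_upwards [hcont, e.open_source.mem_nhds hx] with y hy hys
  rw [← hconst _ hy, e.left_inv hys]

end Kropina

theorem theorem1p4 {n : ℕ} (hn : 2 ≤ n)
    {M : Type*} [TopologicalSpace M] [ChartedSpace (Kropina.Coord n) M]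
    [IsManifold 𝓘(ℝ, Kropina.Coord n) ∞ M] [ConnectedSpace M]
    {M' : Type*} [TopologicalSpace M'] [ChartedSpace (Kropina.Coord n) M']
    [IsManifold 𝓘(ℝ, Kropina.Coord n) ∞ M']
    (K : Kropina.KropinaSpace n M) (K' : Kropina.KropinaSpace n M')
    (hK : K.IsEinstein) (hK' : K'.IsEinstein)
    (f : M → M') (φ : M → ℝ) (hf : Kropina.IsConformalMap K K' f φ) :
    (∃ c : ℝ, ∀ x, φ x = c) ∧ Kropina.IsHomothetic K K' f := by
  obtain ⟨c, hc⟩ := (hf.isLocallyConstant hn hK hK').exists_eq_const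
  have hφ : φ = fun _ => c := by rw [hc]; rfl
  exact ⟨⟨c, fun x => congrFun hφ x⟩, c, hφ ▸ hf⟩
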